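/- Theorem 1. Let $\lambda_e,\lambda>0$. For $n\ge 2$, $C\ge 0$ and $B>0$ consider the following fully connected network of one source and $n$ nodes (the ASUMAN scheme with back-off constant $C$ and total gossip rate $B$). The source updates itself at the times $0<T_1<T_2<\cdots$ of a Poisson process of rate $\lambda_e$ (put $T_0=0$), and independently it sends updates to each node as a Poisson process of rate $\lambda/n$. The version age $\Delta_i(t)\in\{0,1,2,\dots\}$ of node $i$ is $0$ at time $0$; it increases by $1$ whenever the source updates itself, becomes $0$ when node $i$ receives an update from the source, and becomes $\min\{\Delta_j(t),\Delta_i(t)\}$ when node $i$ receives a gossip update from node $j$. Let $\mathcal M_k$ be the set of nodes of minimum age at time $T_k$, and let $\tilde\Delta[k]=\min_i\Delta_i(T_k)$. During $[T_k,T_{k+1})$ only the nodes in $\mathcal M_k$ gossip, and they do so only from time $T_k+C\tilde\Delta[k]$ on (if this is before $T_{k+1}$): from then until $T_{k+1}$ each node in $\mathcal M_k$ sends gossip updates to each other node as an independent Poisson process of rate $\frac{B}{|\mathcal M_k|(n-1)}$. For each $n\ge2$ let the total gossip rate be $B=n\lambda$ and let the back-off constant be $C_n>0$, where the sequence $(C_n)$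 is bounded and $C_n\to0$ as $n\to\infty$. Then for every $n\ge 2$ and every node $i$ the mean $\mathbb E[\Delta_i(t)]$ is finite for all $t\ge0$ and the steady-state mean version age $a_i^{(n)}=\lim_{t\to\infty}\mathbb E[\Delta_i(t)]$ exists. It is $O(1)$: there is a constant $K$ (which may depend on $\lambda_e$, $\lambda$ and the sequence $(C_n)$) with $a_i^{(n)}\le K$ for all $n\ge 2$ and all $i$. Moreover $$\limsup_{n\to\infty}\ \max_{1\le i\le n} a_i^{(n)}\le \frac{2\lambda_e}{\lambda}+1 ,$$ which is the same asymptotic upper bound as for back-off constant $0$: if the back-off constant is $0$ for every $n$ (and $B=n\lambda$), then the steady-state mean version ages also exist, and their maximum over $i$ also has limit superior at most $\frac{2\lambda_e}{\lambda}+1$. -/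

import Mathlib

open MeasureTheory ProbabilityTheory Filter Topology

noncomputable section

namespace Asuman

/-! ### Arrivals inside one interval between two consecutive source self-updates -/

/-- The exponential clocks used in one inter-update interval `[T k, T (k+1))` by a network with
`n` nodes. -/
inductive Clock (n : ℕ) : Type
  /-- the length of the interval, i.e. the time until the next self-update of the source -/
  | source : Clock n
  /-- the `r`-th gap of the stream of updates sent by the source to node `i` -/
  | update (i : Fin n) (r : ℕ) : Clock n
  /-- the `r`-th gap, in units of the mean gap, of the stream of gossip updates from `j` to `l` -/
  | gossip (j l : Fin n) (r : ℕ) : Clock n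

/-- The rate of each clock: the source updates itself with rate `lamE` and each node with rate
`lam / n`; gossip clocks have rate one and are rescaled below, since the gossip rate depends on the
state of the network. -/
def Clock.rate {n : ℕ} (lamE lam : ℝ) : Clock n → ℝ
  | .source => lamE
  | .update _ _ => lam / n
  | .gossip _ _ _ => 1

/-- All clocks of all intervals; `ω k` contains the clocks of the interval `[T k, T (k+1))`. -/
abbrev Noise (n : ℕ) : Type := ℕ → Clock n → ℝ

/-- All clocks are independent and exponentially distributed. The updates of the source to a node
form a Poisson process of rate `lam / n` on `[0, ∞)`, independent of the times `T k`, which is put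
together from independent Poisson processes on the intervals `[T k, T (k+1))`. -/
def noiseLaw (n : ℕ) (lamE lam : ℝ) : Measure (Noise n) :=
  Measure.infinitePi fun _ : ℕ =>
    Measure.infinitePi fun c : Clock n => expMeasure (c.rate lamE lam)

/-- The arrival times `g 0`, `g 0 + g 1`, `g 0 + g 1 + g 2`, … of a stream with gaps `g`. -/
def arrivals (g : ℕ → ℝ) : Set ℝ :=
  {s | ∃ r : ℕ, s = ∑ q ∈ Finset.range (r + 1), g q}

/-- The nodes of minimum age. -/
def minNodes {n : ℕ} (x : Fin n → ℕ) : Finset (Fin n) :=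
  Finset.univ.filter fun j => ∀ i, x j ≤ x i

/-- The rate `B / (|M| (n - 1))` at which each minimum-age node gossips to each other node. -/
def gossipRate {n : ℕ} (B : ℝ) (x : Fin n → ℕ) : ℝ :=
  B / ((minNodes x).card * ((n : ℝ) - 1))

/-- Times (measured from the beginning of the interval) at which the source updates node `i`. -/
def updateTimes {n : ℕ} (ξ : Clock n → ℝ) (i : Fin n) : Set ℝ :=
  arrivals fun r => ξ (.update i r)

/-- Times (measured from the beginning of the interval) at which node `j` sends a gossip update to
node `l`, if the ages at the beginning of the interval are `x`. Only the nodes `j` of minimum age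
gossip, only to other nodes, and only after the back-off time `C * x j`; from then on they do so as
a Poisson process of rate `gossipRate B x`. -/
def gossipTimes {n : ℕ} (B C : ℝ) (x : Fin n → ℕ) (ξ : Clock n → ℝ) (j l : Fin n) : Set ℝ :=
  {s | j ∈ minNodes x ∧ j ≠ l ∧
    s - C * x j ∈ arrivals fun r => ξ (.gossip j l r) / gossipRate B x}

/-! ### Evolution of the ages inside one interval -/

/-- The first time after `s` at which some node is updated by the source or by gossip. -/
def nextEvent {n : ℕ} (B C : ℝ) (x : Fin n → ℕ) (ξ : Clock n → ℝ) (s : ℝ) : ℝ :=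
  sInf {u | s < u ∧ ∃ i, u ∈ updateTimes ξ i ∨ ∃ j, u ∈ gossipTimes B C x ξ j i}

open Classical in
/-- The effect on the ages `y` of the updates arriving at time `u`: a node that is updated by the
source gets age zero; a node that receives gossip keeps the smaller of its own age and the age of
the sender; the age of a node that receives nothing does not change. -/
def reset {n : ℕ} (B C : ℝ) (x : Fin n → ℕ) (ξ : Clock n → ℝ) (u : ℝ) (y : Fin n → ℕ) :
    Fin n → ℕ := fun i =>
  if u ∈ updateTimes ξ i then 0
  else (insert i (Finset.univ.filter fun j => u ∈ gossipTimes B C x ξ j i)).inf'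
    (Finset.insert_nonempty _ _) y

/-- The time of the `r`-th event of the interval, and the ages just after it (`r = 0` is the
beginning of the interval, where the ages are `x`). -/
def stage {n : ℕ} (B C : ℝ) (x : Fin n → ℕ) (ξ : Clock n → ℝ) : ℕ → ℝ × (Fin n → ℕ)
  | 0 => (0, x)
  | r + 1 =>
    let p := stage B C x ξ r
    let u := nextEvent B C x ξ p.1
    (u, reset B C x ξ u p.2)

/-- The ages `s` time units after the beginning of the interval, as long as the source does not
update itself. -/
def agesWithin {n : ℕ} (B C : ℝ) (x : Fin n → ℕ) (ξ : Clock n → ℝ) (s : ℝ) : Fin n → ℕ :=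
  (stage B C x ξ (sSup {r : ℕ | (stage B C x ξ r).1 ≤ s})).2

/-! ### The version age process -/

/-- The time `T k` of the `k`-th self-update of the source, with `T 0 = 0`. -/
def updateEpoch {n : ℕ} (ω : Noise n) (k : ℕ) : ℝ :=
  ∑ q ∈ Finset.range k, ω q .source

/-- The ages at time `T k`: all ages are zero at time `0`, and every age increases by one when the
source updates itself. -/
def agesAtEpoch {n : ℕ} (B C : ℝ) (ω : Noise n) : ℕ → Fin n → ℕ
  | 0 => fun _ => 0
  | k + 1 => fun i => agesWithin B C (agesAtEpoch B C ω k) (ω k) (ω k .source) i + 1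

/-- The number of self-updates of the source up to time `t`. -/
def sourceVersion {n : ℕ} (ω : Noise n) (t : ℝ) : ℕ :=
  sSup {k : ℕ | updateEpoch ω k ≤ t}

/-- The version age of node `i` at time `t`. -/
def versionAge {n : ℕ} (B C : ℝ) (ω : Noise n) (t : ℝ) (i : Fin n) : ℕ :=
  agesWithin B C (agesAtEpoch B C ω (sourceVersion ω t)) (ω (sourceVersion ω t))
    (t - updateEpoch ω (sourceVersion ω t)) i

/-- `a` is the steady-state mean version age of node `i`: the version age has finite mean at all
times `t ≥ 0`, and this mean converges to `a` as `t → ∞`. -/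
def IsSteadyStateMeanAge {n : ℕ} (lamE lam B C : ℝ) (i : Fin n) (a : ℝ) : Prop :=
  (∀ t : ℝ, 0 ≤ t →
    Integrable (fun ω : Noise n => (versionAge B C ω t i : ℝ)) (noiseLaw n lamE lam)) ∧
  Tendsto (fun t : ℝ => ∫ ω : Noise n, (versionAge B C ω t i : ℝ) ∂(noiseLaw n lamE lam))
    atTop (𝓝 a)

end Asuman

end

/-! The ages at the self-updates of the source form a Markov chain `x`, with one independent family of
exponential clocks per interval. Write `m` for the minimal age, `p = lamE / (lamE + lam)`.

*Bound.* In an interval some node is updated by the source with probability `1 - p`, and then the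
next minimum is `1`; otherwise the minimum grows by one. Node `i` either is of minimal age or gets
gossip from the minimal nodes at total rate `n * lam / (n - 1) ≥ lam` after the back-off time `C * m`,
so it misses the minimum with probability at most `p + lam * C * m`. This gives a closed linear system
of inequalities for `M = E m`, `X = E (x i)` and `Y = E (x i * m)`:
`M' ≤ 1 + p M`, `X' ≤ 1 + (1 - p) M + p X + lam C Y`, `Y' ≤ 1 + X + p M + p Y`.
For small `C` it keeps `X` below `2 (lamE + lam) / lam + ε`, uniformly in `n` and in time
(`integral_agesAtEpoch_le`).

*Existence of the limit.* Seen backwards from a fixed time `t`, the gaps between the self-updates have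
the law of the gaps seen forwards from time `0`. Hence the age at time `t` has the same law as the
age obtained by passing through the intervals `N(t), …, 1, 0` in reversed order, starting from
zero ages (`lintegral_epochEvent_age`); the first interval passed through has no influence, because
all ages are zero in it. After an interval in which the source updates all nodes the past is forgotten,
so this backward age is almost surely eventually constant and is dominated by a geometric variable
(`exists_limit_backwardAge`). By dominated convergence the mean ages at time `t` and the mean ages
just before the `k`-th self-update have the same limit, which is one less than the limit of
`E (x i)`; this turns the bound above into `2 lamE / lam + 1 + ε`. The remaining finitely many `n` only
affect the constant of the `O(1)` bound. -/

open scoped ENNReal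

namespace Asuman

/-! ### Dynamics inside one interval -/

/-- The times at which some node receives an update from the source or a gossip update. -/
def eventTimes {n : ℕ} (B C : ℝ) (x : Fin n → ℕ) (ξ : Clock n → ℝ) : Set ℝ :=
  {u | ∃ i, u ∈ updateTimes ξ i ∨ ∃ j, u ∈ gossipTimes B C x ξ j i}

/-- The clocks of one interval are regular if all gaps are positive and no stream of updates
accumulates. Then the event times of the interval form a locally finite set. -/
structure IsRegular {n : ℕ} (ξ : Clock n → ℝ) : Prop where
  pos : ∀ c, 0 < ξ c
  update_unbounded : ∀ i R, ∃ r, R < ∑ q ∈ Finset.range r, ξ (.update i q)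
  gossip_unbounded : ∀ j l R, ∃ r, R < ∑ q ∈ Finset.range r, ξ (.gossip j l q)

lemma pos_of_mem_arrivals {g : ℕ → ℝ} (hg : ∀ q, 0 < g q) {u : ℝ} (hu : u ∈ arrivals g) :
    0 < u := by
  obtain ⟨r, rfl⟩ := hu
  exact Finset.sum_pos (fun q _ => hg q) (by simp)

lemma finite_arrivals_inter_Iic {g : ℕ → ℝ} (hg : ∀ q, 0 < g q)
    (hunb : ∀ R, ∃ r, R < ∑ q ∈ Finset.range r, g q) (s : ℝ) :
    (arrivals g ∩ Set.Iic s).Finite := by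
  obtain ⟨r, hr⟩ := hunb s
  refine ((Finset.range r).finite_toSet.image
    fun k => ∑ q ∈ Finset.range (k + 1), g q).subset ?_
  rintro u ⟨⟨k, rfl⟩, hk⟩
  refine ⟨k, ?_, rfl⟩
  by_contra hkr
  have hkr : r ≤ k + 1 := by simp at hkr; omega
  have := Finset.sum_le_sum_of_subset_of_nonneg (Finset.range_mono hkr)
    (fun q _ _ => (hg q).le : ∀ q ∈ Finset.range (k + 1), q ∉ Finset.range r → 0 ≤ g q)
  have hk' : _ ≤ s := hk
  linarith

lemma exists_mem_arrivals_gt {g : ℕ → ℝ} (hg : ∀ q, 0 < g q)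
    (hunb : ∀ R, ∃ r, R < ∑ q ∈ Finset.range r, g q) (s : ℝ) :
    ∃ u ∈ arrivals g, s < u := by
  obtain ⟨r, hr⟩ := hunb s
  refine ⟨_, ⟨r, rfl⟩, ?_⟩
  rw [Finset.sum_range_succ]
  linarith [hg r]

lemma minNodes_nonempty {n : ℕ} (hn : 0 < n) (x : Fin n → ℕ) : (minNodes x).Nonempty := by
  have : Nonempty (Fin n) := ⟨⟨0, hn⟩⟩
  obtain ⟨j, hj⟩ := Finite.exists_min x
  exact ⟨j, by simpa [minNodes] using hj⟩

lemma gossipRate_pos {n : ℕ} (hn : 2 ≤ n) {B : ℝ} (hB : 0 < B) (x : Fin n → ℕ) :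
    0 < gossipRate B x := by
  have h1 : (0 : ℝ) < (minNodes x).card := by
    exact_mod_cast (minNodes_nonempty (by omega) x).card_pos
  have h2 : (0 : ℝ) < (n : ℝ) - 1 := by
    have : (2 : ℝ) ≤ n := by exact_mod_cast hn
    linarith
  unfold gossipRate
  positivity

section Dynamics

variable {n : ℕ} {B C : ℝ} {x : Fin n → ℕ} {ξ : Clock n → ℝ}

lemma finite_updateTimes_inter_Iic (hξ : IsRegular ξ) (i : Fin n) (s : ℝ) :
    (updateTimes ξ i ∩ Set.Iic s).Finite :=
  finite_arrivals_inter_Iic (fun _ => hξ.pos _) (hξ.update_unbounded i) s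

lemma finite_gossipTimes_inter_Iic (hn : 2 ≤ n) (hB : 0 < B) (hξ : IsRegular ξ)
    (j l : Fin n) (s : ℝ) : (gossipTimes B C x ξ j l ∩ Set.Iic s).Finite := by
  have hρ := gossipRate_pos hn hB x
  have hfin := finite_arrivals_inter_Iic (g := fun r => ξ (.gossip j l r) / gossipRate B x)
    (fun _ => div_pos (hξ.pos _) hρ) (fun R => by
      obtain ⟨r, hr⟩ := hξ.gossip_unbounded j l (R * gossipRate B x)
      refine ⟨r, ?_⟩
      rw [← Finset.sum_div]
      exact (lt_div_iff₀ hρ).2 hr) (s - C * x j)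
  refine (hfin.image fun v => v + C * x j).subset ?_
  rintro u ⟨⟨-, -, hu⟩, hus⟩
  exact ⟨u - C * x j, ⟨hu, by have : u ≤ s := hus; simpa using this⟩, by simp⟩

lemma finite_eventTimes_inter_Iic (hn : 2 ≤ n) (hB : 0 < B) (hξ : IsRegular ξ) (s : ℝ) :
    (eventTimes B C x ξ ∩ Set.Iic s).Finite := by
  have hfin : (⋃ i : Fin n, ((updateTimes ξ i ∩ Set.Iic s) ∪
      ⋃ j : Fin n, (gossipTimes B C x ξ j i ∩ Set.Iic s))).Finite :=
    Set.finite_iUnion fun i => (finite_updateTimes_inter_Iic hξ i s).union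
      (Set.finite_iUnion fun j => finite_gossipTimes_inter_Iic hn hB hξ j i s)
  refine hfin.subset ?_
  rintro u ⟨⟨i, hu⟩, hus⟩
  refine Set.mem_iUnion.2 ⟨i, ?_⟩
  rcases hu with hu | ⟨j, hu⟩
  · exact Or.inl ⟨hu, hus⟩
  · exact Or.inr (Set.mem_iUnion.2 ⟨j, hu, hus⟩)

lemma pos_of_mem_eventTimes (hn : 2 ≤ n) (hB : 0 < B) (hC : 0 ≤ C) (hξ : IsRegular ξ) {u : ℝ}
    (hu : u ∈ eventTimes B C x ξ) : 0 < u := by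
  obtain ⟨i, hu | ⟨j, -, -, hu⟩⟩ := hu
  · exact pos_of_mem_arrivals (fun _ => hξ.pos _) hu
  · have := pos_of_mem_arrivals (fun _ => div_pos (hξ.pos _) (gossipRate_pos hn hB x)) hu
    have : 0 ≤ C * x j := by positivity
    linarith

lemma exists_mem_eventTimes_gt (hn : 2 ≤ n) (hξ : IsRegular ξ) (s : ℝ) :
    ∃ u ∈ eventTimes B C x ξ, s < u := by
  let i : Fin n := ⟨0, by omega⟩
  obtain ⟨u, hu, hsu⟩ := exists_mem_arrivals_gt (fun _ => hξ.pos _) (hξ.update_unbounded i) s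
  exact ⟨u, ⟨i, Or.inl hu⟩, hsu⟩

lemma isLeast_nextEvent (hn : 2 ≤ n) (hB : 0 < B) (hξ : IsRegular ξ) (s : ℝ) :
    IsLeast {u | s < u ∧ u ∈ eventTimes B C x ξ} (nextEvent B C x ξ s) := by
  obtain ⟨v, hv, hsv⟩ := exists_mem_eventTimes_gt (B := B) (C := C) (x := x) hn hξ s
  have hfin : {u | u ∈ eventTimes B C x ξ ∩ Set.Iic v ∧ s < u}.Finite :=
    (finite_eventTimes_inter_Iic hn hB hξ v).subset fun u hu => hu.1
  obtain ⟨w, ⟨⟨hwE, hwv⟩, hsw⟩, hmin⟩ := Set.exists_min_image _ id hfin ⟨v, ⟨hv, Set.mem_Iic.2 le_rfl⟩, hsv⟩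
  have hleast : IsLeast {u | s < u ∧ u ∈ eventTimes B C x ξ} w := by
    refine ⟨⟨hsw, hwE⟩, fun u hu => ?_⟩
    rcases le_total u v with huv | huv
    · exact hmin u ⟨⟨hu.2, huv⟩, hu.1⟩
    · exact le_trans hwv huv
  have : nextEvent B C x ξ s = w := hleast.csInf_eq
  rwa [this]

lemma stage_time_lt_succ (hn : 2 ≤ n) (hB : 0 < B) (hξ : IsRegular ξ) (r : ℕ) :
    (stage B C x ξ r).1 < (stage B C x ξ (r + 1)).1 :=
  (isLeast_nextEvent hn hB hξ _).1.1

lemma strictMono_stage_time (hn : 2 ≤ n) (hB : 0 < B) (hξ : IsRegular ξ) :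
    StrictMono fun r => (stage B C x ξ r).1 :=
  strictMono_nat_of_lt_succ (stage_time_lt_succ hn hB hξ)

lemma finite_stage_time_le (hn : 2 ≤ n) (hB : 0 < B) (hξ : IsRegular ξ) (s : ℝ) :
    {r : ℕ | (stage B C x ξ r).1 ≤ s}.Finite := by
  have hfin := (finite_eventTimes_inter_Iic (C := C) (x := x) hn hB hξ s).insert 0
  refine Set.Finite.of_finite_image (hfin.subset ?_)
    ((strictMono_stage_time (C := C) (x := x) hn hB hξ).injective.injOn)
  rintro _ ⟨r, hr, rfl⟩
  rcases r with _ | r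
  · exact Or.inl rfl
  · exact Or.inr ⟨(isLeast_nextEvent hn hB hξ _).1.2, hr⟩

/-- Every event of a regular interval is reached by the recursion `stage`. -/
lemma exists_stage_time_eq (hn : 2 ≤ n) (hB : 0 < B) (hC : 0 ≤ C) (hξ : IsRegular ξ) {u : ℝ}
    (hu : u ∈ eventTimes B C x ξ) : ∃ r, (stage B C x ξ (r + 1)).1 = u := by
  have hfin : {r : ℕ | (stage B C x ξ r).1 < u}.Finite :=
    (finite_stage_time_le (C := C) (x := x) hn hB hξ u).subset
      fun r (hr : (stage B C x ξ r).1 < u) => hr.le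
  obtain ⟨r, hr, hmax⟩ := Set.exists_max_image _ id hfin
    ⟨0, pos_of_mem_eventTimes hn hB hC hξ hu⟩
  refine ⟨r, le_antisymm ((isLeast_nextEvent hn hB hξ _).2 ⟨hr, hu⟩) ?_⟩
  by_contra! hlt
  have := hmax (r + 1) hlt
  simp at this

lemma reset_le (u : ℝ) (y : Fin n → ℕ) (i : Fin n) : reset B C x ξ u y i ≤ y i := by
  unfold reset
  split_ifs
  · exact Nat.zero_le _
  · exact Finset.inf'_le _ (Finset.mem_insert_self _ _)

lemma antitone_stage_ages (i : Fin n) : Antitone fun r => (stage B C x ξ r).2 i :=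
  antitone_nat_of_succ_le fun _ => reset_le _ _ i

/-- Ages never increase as long as the source does not update itself. -/
lemma agesWithin_le (s : ℝ) (i : Fin n) : agesWithin B C x ξ s i ≤ x i :=
  antitone_stage_ages (B := B) (C := C) (x := x) (ξ := ξ) i (Nat.zero_le _)

lemma agesWithin_le_stage (hn : 2 ≤ n) (hB : 0 < B) (hξ : IsRegular ξ) {s : ℝ} {r : ℕ}
    (hr : (stage B C x ξ r).1 ≤ s) (i : Fin n) :
    agesWithin B C x ξ s i ≤ (stage B C x ξ r).2 i :=
  antitone_stage_ages (B := B) (C := C) (x := x) (ξ := ξ) i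
    (le_csSup (finite_stage_time_le hn hB hξ s).bddAbove hr)

lemma agesWithin_eq_zero_of_update (hn : 2 ≤ n) (hB : 0 < B) (hC : 0 ≤ C) (hξ : IsRegular ξ)
    {u s : ℝ} {i : Fin n} (hu : u ∈ updateTimes ξ i) (hus : u ≤ s) :
    agesWithin B C x ξ s i = 0 := by
  obtain ⟨r, rfl⟩ := exists_stage_time_eq (x := x) hn hB hC hξ ⟨i, Or.inl hu⟩
  refine Nat.le_zero.1 ((agesWithin_le_stage hn hB hξ hus i).trans_eq ?_)
  exact if_pos hu

lemma agesWithin_le_of_gossip (hn : 2 ≤ n) (hB : 0 < B) (hC : 0 ≤ C) (hξ : IsRegular ξ)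
    {u s : ℝ} {i j : Fin n} (hu : u ∈ gossipTimes B C x ξ j i) (hus : u ≤ s) :
    agesWithin B C x ξ s i ≤ x j := by
  classical
  obtain ⟨r, rfl⟩ := exists_stage_time_eq (x := x) hn hB hC hξ ⟨i, Or.inr ⟨j, hu⟩⟩
  refine (agesWithin_le_stage hn hB hξ hus i).trans ?_
  change reset B C x ξ _ _ i ≤ x j
  unfold reset
  split_ifs
  · exact Nat.zero_le _
  · refine le_trans (Finset.inf'_le _ (b := j) (Finset.mem_insert_of_mem (Finset.mem_filter.2 ⟨Finset.mem_univ _, hu⟩))) ?_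
    exact antitone_stage_ages (B := B) (C := C) (x := x) (ξ := ξ) j (Nat.zero_le _)

lemma agesWithin_zero (s : ℝ) : agesWithin B C (0 : Fin n → ℕ) ξ s = 0 :=
  funext fun i => Nat.le_zero.1 (agesWithin_le s i)

lemma agesWithin_update_source [DecidableEq (Clock n)] (a s : ℝ) :
    agesWithin B C x (Function.update ξ .source a) s = agesWithin B C x ξ s := by
  have hU : updateTimes (Function.update ξ .source a) = updateTimes ξ := by
    ext i; simp [updateTimes]
  have hG : gossipTimes B C x (Function.update ξ .source a) = gossipTimes B C x ξ := by
    ext i; simp [gossipTimes]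
  have hS : ∀ r, stage B C x (Function.update ξ .source a) r = stage B C x ξ r := by
    intro r
    induction r with
    | zero => rfl
    | succ r ih =>
      have hE : nextEvent B C x (Function.update ξ .source a) = nextEvent B C x ξ := by
        ext s; simp only [nextEvent, hU, hG]
      have hR : reset B C x (Function.update ξ .source a) = reset B C x ξ := by
        funext u y i
        unfold reset
        rw [hU]
        congr 1
        exact Finset.inf'_congr _ (by rw [hG]) fun _ _ => rfl
      simp only [stage, ih, hE, hR]
  simp only [agesWithin, hS]

end Dynamics

/-! ### Measurability -/

section Measurability

variable {n : ℕ} {B C : ℝ}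

lemma measurable_sSup_nat {α : Type*} [MeasurableSpace α] {A : α → Set ℕ}
    (hA : ∀ r, MeasurableSet {a | r ∈ A a}) : Measurable fun a => sSup (A a) := by
  have hG : ∀ k, MeasurableSet {a | IsGreatest (A a) k} := by
    intro k
    have : {a | IsGreatest (A a) k} = {a | k ∈ A a} ∩ ⋂ r ∈ {r | k < r}, {a | r ∈ A a}ᶜ := by
      ext a
      simp only [IsGreatest, upperBounds, Set.mem_ofPred_eq, Set.mem_inter_iff, Set.mem_iInter,
        Set.mem_compl_iff]
      refine and_congr_right fun _ => ⟨fun h r hr hra => by have := h hra; omega, fun h r hra => ?_⟩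
      by_contra hr
      exact h r (by omega) hra
    rw [this]
    exact (hA k).inter (MeasurableSet.biInter (Set.to_countable _) fun r _ => (hA r).compl)
  have key : ∀ (S : Set ℕ) k, sSup S = k ↔ IsGreatest S k ∨ (k = 0 ∧ ∀ j, ¬ IsGreatest S j) := by
    intro S k
    by_cases h : ∃ j, IsGreatest S j
    · obtain ⟨j, hj⟩ := h
      rw [hj.csSup_eq]
      constructor
      · rintro rfl; exact Or.inl hj
      · rintro (hk | ⟨-, hk⟩)
        · exact hj.unique hk
        · exact absurd hj (hk j)
    · push Not at h
      have : sSup S = 0 := by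
        rcases S.eq_empty_or_nonempty with rfl | hne
        · simp
        · by_cases hb : BddAbove S
          · exact absurd ⟨Nat.sSup_mem hne hb, fun r hr => le_csSup hb hr⟩ (h _)
          · exact Nat.sSup_of_not_bddAbove hb
      rw [this]
      simp [h, eq_comm]
  refine measurable_to_countable' fun k => ?_
  have : (fun a => sSup (A a)) ⁻¹' {k} =
      {a | IsGreatest (A a) k} ∪ {a | k = 0 ∧ ∀ j, ¬ IsGreatest (A a) j} := by
    ext a; simpa using key (A a) k
  rw [this]
  refine (hG k).union ?_
  rw [Set.ofPred_and]
  refine (MeasurableSet.const _).inter ?_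
  rw [Set.ofPred_forall]
  exact MeasurableSet.iInter fun j => (hG j).compl

lemma measurable_sInf_gt {α ι : Type*} [MeasurableSpace α] [Countable ι] {f : ι → α → ℝ}
    (hf : ∀ i, Measurable (f i)) {s : α → ℝ} (hs : Measurable s) :
    Measurable fun a => sInf {u | s a < u ∧ ∃ i, u = f i a} := by
  refine measurable_of_Iio fun y => ?_
  have : (fun a => sInf {u | s a < u ∧ ∃ i, u = f i a}) ⁻¹' Set.Iio y =
      (⋃ i, {a | s a < f i a} ∩ {a | f i a < y}) ∪
        ((⋂ i, {a | s a < f i a}ᶜ) ∩ {_a | 0 < y}) := by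
    ext a
    simp only [Set.mem_preimage, Set.mem_Iio, Set.mem_union, Set.mem_iUnion, Set.mem_inter_iff,
      Set.mem_ofPred_eq, Set.mem_iInter, Set.mem_compl_iff]
    by_cases h : ∃ i, s a < f i a
    · have hne : {u | s a < u ∧ ∃ i, u = f i a}.Nonempty := by
        obtain ⟨i, hi⟩ := h
        exact ⟨f i a, hi, i, rfl⟩
      have hb : BddBelow {u | s a < u ∧ ∃ i, u = f i a} := ⟨s a, fun u hu => hu.1.le⟩
      rw [csInf_lt_iff hb hne]
      constructor
      · rintro ⟨_, ⟨h1, i, rfl⟩, h2⟩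
        exact Or.inl ⟨i, h1, h2⟩
      · rintro (⟨i, h1, h2⟩ | ⟨h1, -⟩)
        · exact ⟨_, ⟨h1, i, rfl⟩, h2⟩
        · obtain ⟨i, hi⟩ := h
          exact absurd hi (h1 i)
    · have hempty : {u | s a < u ∧ ∃ i, u = f i a} = ∅ := by
        ext u
        simp only [Set.mem_ofPred_eq, Set.mem_empty_iff_false, iff_false]
        rintro ⟨h1, i, rfl⟩
        exact h ⟨i, h1⟩
      push Not at h
      rw [hempty, Real.sInf_empty]
      constructor
      · exact fun h0 => Or.inr ⟨fun i => not_lt.2 (h i), h0⟩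
      · rintro (⟨i, h1, -⟩ | ⟨-, h2⟩)
        · exact absurd h1 (not_lt.2 (h i))
        · exact h2
  rw [this]
  exact (MeasurableSet.iUnion fun i => (measurableSet_lt hs (hf i)).inter
    (measurableSet_lt (hf i) measurable_const)).union
    ((MeasurableSet.iInter fun i => (measurableSet_lt hs (hf i)).compl).inter
      (MeasurableSet.const _))

lemma measurable_nextEvent (x : Fin n → ℕ) :
    Measurable fun p : (Clock n → ℝ) × ℝ => nextEvent B C x p.1 p.2 := by
  let f : (Fin n × ℕ) ⊕ ({jl : Fin n × Fin n // jl.1 ∈ minNodes x ∧ jl.1 ≠ jl.2} × ℕ) →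
      (Clock n → ℝ) × ℝ → ℝ
    | .inl a => fun p => ∑ q ∈ Finset.range (a.2 + 1), p.1 (.update a.1 q)
    | .inr a => fun p => C * x a.1.1.1 +
        ∑ q ∈ Finset.range (a.2 + 1), p.1 (.gossip a.1.1.1 a.1.1.2 q) / gossipRate B x
  have hf : ∀ a, Measurable (f a) := by
    rintro (a | a) <;> simp only [f] <;> fun_prop
  convert measurable_sInf_gt hf measurable_snd using 2 with p
  unfold nextEvent
  congr 1
  ext u
  refine and_congr_right fun _ => ?_
  constructor
  · rintro ⟨i, ⟨r, hr⟩ | ⟨j, hj, hji, r, hr⟩⟩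
    · exact ⟨.inl (i, r), hr⟩
    · exact ⟨.inr (⟨(j, i), hj, hji⟩, r), by simp only [f]; linarith⟩
  · rintro ⟨⟨i, r⟩ | ⟨⟨⟨j, l⟩, hj, hjl⟩, r⟩, hr⟩
    · exact ⟨i, Or.inl ⟨r, hr⟩⟩
    · exact ⟨l, Or.inr ⟨j, hj, hjl, r, by simp only [f] at hr; linarith⟩⟩

lemma measurableSet_mem_updateTimes (i : Fin n) :
    MeasurableSet {p : (Clock n → ℝ) × ℝ | p.2 ∈ updateTimes p.1 i} := by
  have : {p : (Clock n → ℝ) × ℝ | p.2 ∈ updateTimes p.1 i} =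
      ⋃ r : ℕ, {p | p.2 = ∑ q ∈ Finset.range (r + 1), p.1 (.update i q)} := by
    ext p; simp [updateTimes, arrivals]
  rw [this]
  exact MeasurableSet.iUnion fun r => measurableSet_eq_fun (by fun_prop) (by fun_prop)

lemma measurableSet_mem_gossipTimes (x : Fin n → ℕ) (j l : Fin n) :
    MeasurableSet {p : (Clock n → ℝ) × ℝ | p.2 ∈ gossipTimes B C x p.1 j l} := by
  have : {p : (Clock n → ℝ) × ℝ | p.2 ∈ gossipTimes B C x p.1 j l} =
      {_p | j ∈ minNodes x ∧ j ≠ l} ∩ ⋃ r : ℕ, {p | p.2 - C * x j =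
        ∑ q ∈ Finset.range (r + 1), p.1 (.gossip j l q) / gossipRate B x} := by
    ext p; simp [gossipTimes, arrivals, and_assoc]
  rw [this]
  exact (MeasurableSet.const _).inter
    (MeasurableSet.iUnion fun r => measurableSet_eq_fun (by fun_prop) (by fun_prop))

lemma measurable_reset (x : Fin n → ℕ) :
    Measurable fun p : ((Clock n → ℝ) × ℝ) × (Fin n → ℕ) => reset B C x p.1.1 p.1.2 p.2 := by
  classical
  refine measurable_pi_lambda _ fun i => ?_
  unfold reset
  refine Measurable.ite (measurable_fst (measurableSet_mem_updateTimes i)) measurable_const ?_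
  let F : (Fin n → Prop) × (Fin n → ℕ) → ℕ := fun b =>
    (insert i (Finset.univ.filter fun j => b.1 j)).inf' (Finset.insert_nonempty _ _) b.2
  have hF : Measurable F := Measurable.of_discrete
  have hb : Measurable fun p : ((Clock n → ℝ) × ℝ) × (Fin n → ℕ) =>
      ((fun j => p.1.2 ∈ gossipTimes B C x p.1.1 j i : Fin n → Prop), p.2) := by
    refine Measurable.prodMk (measurable_pi_lambda _ fun j => ?_) measurable_snd
    exact measurableSet_setOfPred.1 (measurable_fst (measurableSet_mem_gossipTimes x j i))
  convert hF.comp hb using 2 with p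
  simp only [F, Function.comp_apply]

lemma measurable_stage (x : Fin n → ℕ) (r : ℕ) :
    Measurable fun ξ : Clock n → ℝ => stage B C x ξ r := by
  induction r with
  | zero => exact measurable_const
  | succ r ih =>
    have h1 : Measurable fun ξ : Clock n → ℝ => nextEvent B C x ξ (stage B C x ξ r).1 :=
      (measurable_nextEvent x).comp (measurable_id.prodMk ih.fst)
    exact h1.prodMk ((measurable_reset x).comp ((measurable_id.prodMk h1).prodMk ih.snd))

/-- The ages inside one interval depend measurably on the clocks, the time and the initial ages. -/
lemma measurable_agesWithin :
    Measurable fun p : (Fin n → ℕ) × (Clock n → ℝ) × ℝ => agesWithin B C p.1 p.2.1 p.2.2 := by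
  refine measurable_from_prod_countable_right fun x => ?_
  have hR : Measurable fun p : (Clock n → ℝ) × ℝ =>
      sSup {r : ℕ | (stage B C x p.1 r).1 ≤ p.2} :=
    measurable_sSup_nat fun r =>
      measurableSet_le ((measurable_stage x r).fst.comp measurable_fst) measurable_snd
  have hS : Measurable fun p : ℕ × (Clock n → ℝ) => (stage B C x p.2 p.1).2 :=
    measurable_from_prod_countable_right fun r => (measurable_stage x r).snd
  exact hS.comp (hR.prodMk measurable_fst)

@[fun_prop]
lemma measurable_agesAtEpoch (k : ℕ) : Measurable fun ω : Noise n => agesAtEpoch B C ω k := by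
  induction k with
  | zero => exact measurable_const
  | succ k ih =>
    have h : Measurable fun ω : Noise n =>
        agesWithin B C (agesAtEpoch B C ω k) (ω k) (ω k .source) :=
      measurable_agesWithin.comp (ih.prodMk (Measurable.prodMk (by fun_prop) (by fun_prop)))
    refine measurable_pi_lambda _ fun i => ?_
    exact (measurable_of_countable (fun m : ℕ => m + 1)).comp ((measurable_pi_apply i).comp h)

@[fun_prop]
lemma measurable_updateEpoch (k : ℕ) : Measurable fun ω : Noise n => updateEpoch ω k := by
  unfold updateEpoch
  fun_prop

lemma measurable_versionAge (t : ℝ) (i : Fin n) :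
    Measurable fun ω : Noise n => versionAge B C ω t i := by
  have hN : Measurable fun ω : Noise n => sourceVersion ω t :=
    measurable_sSup_nat fun k => measurableSet_le (measurable_updateEpoch k) measurable_const
  have h : Measurable fun p : ℕ × Noise n =>
      agesWithin B C (agesAtEpoch B C p.2 p.1) (p.2 p.1) (t - updateEpoch p.2 p.1) i := by
    refine measurable_from_prod_countable_right fun k => ?_
    exact (measurable_pi_apply i).comp (measurable_agesWithin.comp
      ((measurable_agesAtEpoch k).prodMk (Measurable.prodMk (by fun_prop)
        (measurable_const.sub (measurable_updateEpoch k)))))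
  exact h.comp (hN.prodMk measurable_id)

end Measurability

/-! ### Infinite product measures -/

lemma measurable_update_prod {ι : Type*} {X : ι → Type*} [∀ i, MeasurableSpace (X i)]
    [DecidableEq ι] (i : ι) :
    Measurable fun p : (∀ i, X i) × X i => Function.update p.1 i p.2 := by
  refine measurable_pi_lambda _ fun j => ?_
  rcases eq_or_ne j i with rfl | hj
  · simpa using measurable_snd
  · simp only [Function.update_of_ne hj]
    fun_prop

section InfinitePi

variable {ι : Type*} {X : ι → Type*} [∀ i, MeasurableSpace (X i)] (μ : ∀ i, Measure (X i))
  [∀ i, IsProbabilityMeasure (μ i)]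

/-- Replacing one coordinate of a product measure by an independent copy does not change the
law. -/
lemma infinitePi_map_update [DecidableEq ι] (i : ι) :
    ((Measure.infinitePi μ).prod (μ i)).map (fun p => Function.update p.1 i p.2) =
      Measure.infinitePi μ := by
  refine Measure.eq_infinitePi μ fun s t ht => ?_
  rw [Measure.map_apply (measurable_update_prod i) (.pi s.countable_toSet fun _ _ => ht _)]
  have hset : (fun p : (∀ i, X i) × X i => Function.update p.1 i p.2) ⁻¹' Set.pi s t =
      (Set.pi (s.erase i : Finset ι) t) ×ˢ (if i ∈ s then t i else Set.univ) := by
    ext p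
    simp only [Set.mem_preimage, Set.mem_pi, Set.mem_prod, Finset.mem_coe, Finset.mem_erase]
    constructor
    · intro h
      refine ⟨fun j hj => by simpa [hj.1] using h j hj.2, ?_⟩
      split_ifs with hi
      · simpa using h i hi
      · trivial
    · rintro ⟨h1, h2⟩ j hj
      rcases eq_or_ne j i with rfl | hji
      · simpa [hj] using h2
      · simpa [hji] using h1 j ⟨hji, hj⟩
  rw [hset, Measure.prod_prod, Measure.infinitePi_pi μ fun i _ => ht i]
  split_ifs with hi
  · rw [mul_comm, Finset.mul_prod_erase s (fun i => μ i (t i)) hi]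
  · simp [Finset.erase_eq_of_notMem hi]

lemma lintegral_infinitePi_update [DecidableEq ι] (i : ι) {f : (∀ i, X i) → ℝ≥0∞}
    (hf : Measurable f) :
    ∫⁻ ω, f ω ∂(Measure.infinitePi μ) =
      ∫⁻ ω, ∫⁻ a, f (Function.update ω i a) ∂(μ i) ∂(Measure.infinitePi μ) := by
  conv_lhs => rw [← infinitePi_map_update μ i]
  rw [lintegral_map hf (measurable_update_prod i),
    lintegral_prod (fun p => f (Function.update p.1 i p.2))
      (hf.comp (measurable_update_prod i)).aemeasurable]

/-- If each of infinitely many independent events has probability at most `θ < 1`, then almost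
surely infinitely many of them fail. -/
lemma ae_frequently_notMem_infinitePi {e : ℕ → ι} (he : Function.Injective e)
    {A : ∀ i, Set (X i)} (hA : ∀ i, MeasurableSet (A i)) {θ : ℝ≥0∞} (hθ : θ < 1)
    (hAθ : ∀ q, μ (e q) (A (e q)) ≤ θ) :
    ∀ᵐ ω ∂(Measure.infinitePi μ), ∀ N, ∃ q, N ≤ q ∧ ω (e q) ∉ A (e q) := by
  classical
  rw [ae_all_iff]
  intro N
  rw [ae_iff]
  have hle : ∀ r : ℕ, Measure.infinitePi μ {ω | ¬ ∃ q, N ≤ q ∧ ω (e q) ∉ A (e q)} ≤ θ ^ r := by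
    intro r
    calc _ ≤ Measure.infinitePi μ (Set.pi ((Finset.Ico N (N + r)).image e : Finset ι) A) := by
          refine measure_mono fun ω hω i hi => ?_
          obtain ⟨q, hq, rfl⟩ := Finset.mem_image.1 (Finset.mem_coe.1 hi)
          by_contra hne
          exact hω ⟨q, (Finset.mem_Ico.1 hq).1, hne⟩
      _ = ∏ q ∈ Finset.Ico N (N + r), μ (e q) (A (e q)) := by
          rw [Measure.infinitePi_pi μ fun i _ => hA i, Finset.prod_image he.injOn]
      _ ≤ ∏ q ∈ Finset.Ico N (N + r), θ := Finset.prod_le_prod' fun q _ => hAθ q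
      _ = θ ^ r := by simp
  exact le_antisymm (ge_of_tendsto' (ENNReal.tendsto_pow_atTop_nhds_zero_of_lt_one hθ) hle)
    zero_le

end InfinitePi

lemma exists_lt_sum_of_frequently {g : ℕ → ℝ} (hg : ∀ q, 0 < g q)
    (hfreq : ∀ N, ∃ q, N ≤ q ∧ 1 ≤ g q) (R : ℝ) : ∃ r, R < ∑ q ∈ Finset.range r, g q := by
  have key : ∀ M : ℕ, ∃ r, (M : ℝ) ≤ ∑ q ∈ Finset.range r, g q := by
    intro M
    induction M with
    | zero => exact ⟨0, by simp⟩
    | succ M ih =>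
      obtain ⟨r, hr⟩ := ih
      obtain ⟨q, hq, hgq⟩ := hfreq r
      refine ⟨q + 1, ?_⟩
      have := Finset.sum_le_sum_of_subset_of_nonneg (Finset.range_mono hq)
        (fun p _ _ => (hg p).le : ∀ p ∈ Finset.range q, p ∉ Finset.range r → 0 ≤ g p)
      rw [Finset.sum_range_succ]
      push_cast
      linarith
  obtain ⟨M, hM⟩ := exists_nat_gt R
  obtain ⟨r, hr⟩ := key M
  exact ⟨r, hM.trans_le hr⟩

/-! ### Exponential clocks -/

section Exponential

variable {r : ℝ}

lemma expMeasure_Ioi (hr : 0 < r) (t : ℝ) :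
    expMeasure r (Set.Ioi t) = ENNReal.ofReal (Real.exp (-(r * max t 0))) := by
  have := isProbabilityMeasure_expMeasure hr
  have h := cdf_expMeasure_eq hr t
  rw [cdf_eq_real] at h
  rw [← Set.compl_Iic, prob_compl_eq_one_sub measurableSet_Iic,
    ← ENNReal.ofReal_toReal (measure_ne_top (expMeasure r) (Set.Iic t)), ← measureReal_def, h,
    ← ENNReal.ofReal_one, ← ENNReal.ofReal_sub]
  · split_ifs with ht
    · rw [max_eq_left ht]; ring_nf
    · rw [max_eq_right (by linarith)]; simp
  · split_ifs with ht
    · have : Real.exp (-(r * t)) ≤ 1 := Real.exp_le_one_iff.2 (by nlinarith)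
      linarith
    · exact le_rfl

lemma ae_pos_expMeasure (hr : 0 < r) : ∀ᵐ a ∂(expMeasure r), 0 < a := by
  have := isProbabilityMeasure_expMeasure hr
  have h : expMeasure r (Set.Ioi 0) = 1 := by simp [expMeasure_Ioi hr]
  exact (prob_compl_eq_zero_iff measurableSet_Ioi).2 h

lemma expMeasure_Iio_lt_one (hr : 0 < r) (t : ℝ) : expMeasure r (Set.Iio t) < 1 := by
  have := isProbabilityMeasure_expMeasure hr
  refine lt_of_le_of_ne prob_le_one fun h => ?_
  rw [← prob_compl_eq_zero_iff measurableSet_Iio, Set.compl_Iio] at h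
  have h2 := (measure_mono (Set.Ioi_subset_Ici_self (a := t))).trans_eq h
  rw [expMeasure_Ioi hr] at h2
  simp only [nonpos_iff_eq_zero, ENNReal.ofReal_eq_zero] at h2
  exact absurd h2 (not_le.2 (Real.exp_pos _))

lemma lintegral_expMeasure {f : ℝ → ℝ≥0∞} (hf : Measurable f) :
    ∫⁻ a, f a ∂(expMeasure r) = ∫⁻ a, exponentialPDF r a * f a :=
  lintegral_withDensity_eq_lintegral_mul _ (measurable_exponentialPDFReal r).ennreal_ofReal hf

/-- The Laplace transform of the exponential distribution. -/
lemma lintegral_exp_neg_expMeasure (hr : 0 < r) {l : ℝ} (hl : 0 < l) :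
    ∫⁻ a, ENNReal.ofReal (Real.exp (-(l * a))) ∂(expMeasure r) = ENNReal.ofReal (r / (r + l)) := by
  rw [lintegral_expMeasure (by fun_prop)]
  have h : ∀ a, exponentialPDF r a * ENNReal.ofReal (Real.exp (-(l * a))) =
      ENNReal.ofReal (r / (r + l)) * exponentialPDF (r + l) a := by
    intro a
    rcases lt_or_ge a 0 with ha | ha
    · simp [exponentialPDF_of_neg ha]
    · rw [exponentialPDF_of_nonneg ha, exponentialPDF_of_nonneg ha,
        ← ENNReal.ofReal_mul (by positivity), ← ENNReal.ofReal_mul (by positivity)]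
      congr 1
      rw [show -((r + l) * a) = -(r * a) + -(l * a) by ring, Real.exp_add]
      field_simp
  simp_rw [h]
  rw [lintegral_const_mul (f := exponentialPDF (r + l)) _
      (measurable_exponentialPDFReal _).ennreal_ofReal,
    lintegral_exponentialPDF_eq_one (by positivity), mul_one]

/-- Let `a` and `b` be independent exponential variables of the same rate. On the event that `a` is the
last arrival before `ρ` and `a + b` the next one, the time `ρ - a` elapsed since that arrival is
distributed as `b` on the event that the arrivals are `b` and `b + a` instead. -/
lemma lintegral_expMeasure_age (hr : 0 < r) (ρ : ℝ) {h : ℝ → ℝ≥0∞} (hh : Measurable h) :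
    ∫⁻ a, ∫⁻ b, {p : ℝ × ℝ | p.1 ≤ ρ ∧ ρ < p.1 + p.2}.indicator (fun p => h (ρ - p.1)) (a, b)
        ∂(expMeasure r) ∂(expMeasure r) =
      ∫⁻ a, ∫⁻ b, {p : ℝ × ℝ | p.2 ≤ ρ ∧ ρ < p.1 + p.2}.indicator (fun p => h p.2) (a, b)
        ∂(expMeasure r) ∂(expMeasure r) := by
  have := isProbabilityMeasure_expMeasure hr
  have hexp : ∀ c, Measurable fun a : ℝ => ENNReal.ofReal (Real.exp (-(r * (c - a)))) :=
    fun c => by fun_prop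
  have hset : MeasurableSet {p : ℝ × ℝ | p.2 ≤ ρ ∧ ρ < p.1 + p.2} :=
    (measurableSet_le measurable_snd measurable_const).inter
      (measurableSet_lt measurable_const (measurable_fst.add measurable_snd))
  -- the two inner integrals are exponential tails
  have hL : ∀ a, ∫⁻ b, {p : ℝ × ℝ | p.1 ≤ ρ ∧ ρ < p.1 + p.2}.indicator
      (fun p => h (ρ - p.1)) (a, b) ∂(expMeasure r) =
      (Set.Iic ρ).indicator (fun a => h (ρ - a) * ENNReal.ofReal (Real.exp (-(r * (ρ - a))))) a := by
    intro a
    by_cases ha : a ≤ ρ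
    · have : ∀ b, {p : ℝ × ℝ | p.1 ≤ ρ ∧ ρ < p.1 + p.2}.indicator (fun p => h (ρ - p.1)) (a, b) =
          (Set.Ioi (ρ - a)).indicator (fun _ => h (ρ - a)) b := by
        intro b
        simp only [Set.indicator, Set.mem_ofPred_eq, Set.mem_Ioi, ha, true_and,
          sub_lt_iff_lt_add']
      simp_rw [this]
      rw [lintegral_indicator measurableSet_Ioi, setLIntegral_const, expMeasure_Ioi hr,
        max_eq_left (by linarith), Set.indicator_of_mem (Set.mem_Iic.2 ha)]
    · simp [Set.indicator, ha]
  have hR : ∀ b, ∫⁻ a, {p : ℝ × ℝ | p.2 ≤ ρ ∧ ρ < p.1 + p.2}.indicator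
      (fun p => h p.2) (a, b) ∂(expMeasure r) =
      (Set.Iic ρ).indicator (fun b => h b * ENNReal.ofReal (Real.exp (-(r * (ρ - b))))) b := by
    intro b
    by_cases hb : b ≤ ρ
    · have : ∀ a, {p : ℝ × ℝ | p.2 ≤ ρ ∧ ρ < p.1 + p.2}.indicator (fun p => h p.2) (a, b) =
          (Set.Ioi (ρ - b)).indicator (fun _ => h b) a := by
        intro a
        simp only [Set.indicator, Set.mem_ofPred_eq, Set.mem_Ioi, hb, true_and,
          sub_lt_iff_lt_add]
      simp_rw [this]
      rw [lintegral_indicator measurableSet_Ioi, setLIntegral_const, expMeasure_Ioi hr,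
        max_eq_left (by linarith), Set.indicator_of_mem (Set.mem_Iic.2 hb)]
    · simp [Set.indicator, hb]
  rw [lintegral_lintegral_swap (f := fun a b => {p : ℝ × ℝ | p.2 ≤ ρ ∧ ρ < p.1 + p.2}.indicator
    (fun p => h p.2) (a, b)) ((hh.comp measurable_snd).indicator hset).aemeasurable]
  simp_rw [hL, hR]
  rw [lintegral_expMeasure (f := (Set.Iic ρ).indicator
      fun a => h (ρ - a) * ENNReal.ofReal (Real.exp (-(r * (ρ - a)))))
      (((hh.comp (measurable_const.sub measurable_id)).mul (hexp ρ)).indicator measurableSet_Iic),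
    lintegral_expMeasure (f := (Set.Iic ρ).indicator
      fun b => h b * ENNReal.ofReal (Real.exp (-(r * (ρ - b)))))
      ((hh.mul (hexp ρ)).indicator measurableSet_Iic),
    -- the density times the tail is constant, and `a ↦ ρ - a` maps `[0, ρ]` onto itself
    ← lintegral_sub_left_eq_self (fun b => exponentialPDF r b * (Set.Iic ρ).indicator
      (fun b => h b * ENNReal.ofReal (Real.exp (-(r * (ρ - b))))) b) ρ]
  refine lintegral_congr fun a => ?_
  by_cases ha : 0 ≤ a ∧ a ≤ ρ
  · rw [Set.indicator_of_mem (Set.mem_Iic.2 ha.2),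
      Set.indicator_of_mem (Set.mem_Iic.2 (by linarith)), exponentialPDF_of_nonneg ha.1,
      exponentialPDF_of_nonneg (by linarith), mul_left_comm,
      mul_left_comm (ENNReal.ofReal (r * _)), ← ENNReal.ofReal_mul (by positivity),
      ← ENNReal.ofReal_mul (by positivity), mul_assoc, mul_assoc, ← Real.exp_add, ← Real.exp_add]
    congr 4
    ring
  · rcases not_and_or.1 ha with ha | ha
    · rw [exponentialPDF_of_neg (by linarith), Set.indicator_of_notMem (a := ρ - a) (by
        simp only [Set.mem_Iic]; linarith)]
      simp
    · rw [exponentialPDF_of_neg (x := ρ - a) (by linarith),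
        Set.indicator_of_notMem (a := a) (by simpa using ha)]
      simp

end Exponential

/-! ### The clocks of one interval -/

section ClockLaw

variable {n : ℕ} {lamE lam : ℝ}

/-- The law of the clocks of one interval. -/
noncomputable def clockLaw (n : ℕ) (lamE lam : ℝ) : Measure (Clock n → ℝ) :=
  Measure.infinitePi fun c : Clock n => expMeasure (c.rate lamE lam)

lemma noiseLaw_eq : noiseLaw n lamE lam = Measure.infinitePi fun _ : ℕ => clockLaw n lamE lam :=
  rfl

variable [hE : Fact (0 < lamE)] [hl : Fact (0 < lam)]

lemma Clock.rate_pos (c : Clock n) : 0 < c.rate lamE lam := by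
  cases c with
  | source => exact hE.out
  | update i r =>
    have : (0 : ℝ) < n := by exact_mod_cast i.pos
    exact div_pos hl.out this
  | gossip j l r => exact one_pos

instance (c : Clock n) : IsProbabilityMeasure (expMeasure (c.rate lamE lam)) :=
  isProbabilityMeasure_expMeasure c.rate_pos

instance : IsProbabilityMeasure (clockLaw n lamE lam) := by
  unfold clockLaw; infer_instance

instance : IsProbabilityMeasure (noiseLaw n lamE lam) := by
  rw [noiseLaw_eq]; infer_instance

lemma ae_clock_pos (c : Clock n) : ∀ᵐ ξ ∂(clockLaw n lamE lam), 0 < ξ c :=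
  (measurePreserving_eval_infinitePi (fun c : Clock n => expMeasure (c.rate lamE lam)) c
    ).quasiMeasurePreserving.ae (ae_pos_expMeasure c.rate_pos)

lemma Clock.countable : Countable (Clock n) := by
  let f : Clock n → Unit ⊕ (Fin n × ℕ) ⊕ (Fin n × Fin n × ℕ)
    | .source => .inl ()
    | .update i r => .inr (.inl (i, r))
    | .gossip j l r => .inr (.inr (j, l, r))
  refine Function.Injective.countable (f := f) fun c d h => ?_
  cases c <;> cases d <;> simp_all [f]

lemma ae_clock_frequently {e : ℕ → Clock n} (he : Function.Injective e) {ρ : ℝ} (hρ : 0 < ρ)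
    (hrate : ∀ q, (e q).rate lamE lam = ρ) :
    ∀ᵐ ξ ∂(clockLaw n lamE lam), ∀ N, ∃ q, N ≤ q ∧ 1 ≤ ξ (e q) := by
  filter_upwards [ae_frequently_notMem_infinitePi
    (fun c : Clock n => expMeasure (c.rate lamE lam)) he (A := fun _ => Set.Iio 1)
    (fun _ => measurableSet_Iio) (expMeasure_Iio_lt_one hρ 1) (fun q => by rw [hrate])] with ξ hξ N
  obtain ⟨q, hq, hne⟩ := hξ N
  exact ⟨q, hq, by simpa using hne⟩

lemma ae_isRegular : ∀ᵐ ξ ∂(clockLaw n lamE lam), IsRegular ξ := by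
  have := Clock.countable (n := n)
  have hpos : ∀ᵐ ξ ∂(clockLaw n lamE lam), ∀ c, 0 < ξ c := ae_all_iff.2 ae_clock_pos
  have hU : ∀ᵐ ξ ∂(clockLaw n lamE lam), ∀ i : Fin n, ∀ N, ∃ q, N ≤ q ∧ 1 ≤ ξ (.update i q) :=
    ae_all_iff.2 fun i => ae_clock_frequently (e := fun q => .update i q)
      (fun a b h => by simpa using h) (ρ := lam / n)
      (div_pos hl.out (by exact_mod_cast i.pos)) (fun q => rfl)
  have hG : ∀ᵐ ξ ∂(clockLaw n lamE lam), ∀ j l : Fin n, ∀ N, ∃ q, N ≤ q ∧ 1 ≤ ξ (.gossip j l q) :=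
    ae_all_iff.2 fun j => ae_all_iff.2 fun l => ae_clock_frequently (e := fun q => .gossip j l q)
      (fun a b h => by simpa using h) one_pos (fun q => rfl)
  filter_upwards [hpos, hU, hG] with ξ h1 h2 h3
  exact ⟨h1, fun i => exists_lt_sum_of_frequently (fun _ => h1 _) (h2 i),
    fun j l => exists_lt_sum_of_frequently (fun _ => h1 _) (h3 j l)⟩

lemma exp_neg_max_le {l a d : ℝ} (hl : 0 < l) (hd : 0 ≤ d) :
    Real.exp (-(l * max (a - d) 0)) ≤ Real.exp (-(l * a)) + l * d := by
  rcases le_total d a with h | h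
  · rw [max_eq_left (by linarith)]
    have h1 : Real.exp (-(l * a)) = Real.exp (-(l * (a - d))) * Real.exp (-(l * d)) := by
      rw [← Real.exp_add]; ring_nf
    have h2 : 1 - l * d ≤ Real.exp (-(l * d)) := by
      have := Real.add_one_le_exp (-(l * d)); linarith
    have h3 : Real.exp (-(l * (a - d))) ≤ 1 := Real.exp_le_one_iff.2 (by nlinarith)
    have h4 := Real.exp_pos (-(l * (a - d)))
    have h5 : 0 ≤ l * d := by positivity
    nlinarith
  · rw [max_eq_right (by linarith)]
    have := Real.add_one_le_exp (-(l * a))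
    simp only [mul_zero, neg_zero, Real.exp_zero]
    nlinarith

/-- The probability that none of the clocks in `S`, run at speed `ρ` from time `d` on, rings before
the end of the interval, if their total rate is at least `lam`. -/
lemma clockLaw_forall_lt_le (S : Finset (Clock n)) (hS : Clock.source ∉ S) {ρ d : ℝ} (hρ : 0 < ρ)
    (hd : 0 ≤ d) (hrate : lam ≤ ρ * ∑ c ∈ S, c.rate lamE lam) :
    clockLaw n lamE lam {ξ | ∀ c ∈ S, ρ * (ξ .source - d) < ξ c} ≤
      ENNReal.ofReal (lamE / (lamE + lam) + lam * d) := by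
  classical
  have hE' := hE.out
  have hl' := hl.out
  have hmeas : MeasurableSet {ξ : Clock n → ℝ | ∀ c ∈ S, ρ * (ξ .source - d) < ξ c} := by
    simp only [Set.ofPred_forall]
    exact MeasurableSet.biInter S.countable_toSet fun c _ =>
      measurableSet_lt (by fun_prop) (by fun_prop)
  rw [← lintegral_indicator_one hmeas, clockLaw,
    lintegral_infinitePi_update (fun c : Clock n => expMeasure (c.rate lamE lam)) .source
      (measurable_one.indicator hmeas), lintegral_lintegral_swap]
  swap
  · exact ((measurable_one.indicator hmeas).comp (measurable_update_prod _)).aemeasurable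
  have hinner : ∀ a : ℝ, ∫⁻ ξ, {ξ : Clock n → ℝ | ∀ c ∈ S, ρ * (ξ .source - d) < ξ c}.indicator
      1 (Function.update ξ .source a)
        ∂(Measure.infinitePi fun c : Clock n => expMeasure (c.rate lamE lam)) ≤
      ENNReal.ofReal (Real.exp (-(lam * a))) + ENNReal.ofReal (lam * d) := by
    intro a
    have h1 : ∀ ξ : Clock n → ℝ, {ξ : Clock n → ℝ | ∀ c ∈ S, ρ * (ξ .source - d) < ξ c}.indicator
        (1 : (Clock n → ℝ) → ℝ≥0∞) (Function.update ξ .source a) =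
        (Set.pi S fun _ : Clock n => Set.Ioi (ρ * (a - d))).indicator 1 ξ := by
      intro ξ
      simp only [Set.indicator, Set.mem_ofPred_eq, Set.mem_pi, Finset.mem_coe, Set.mem_Ioi,
        Function.update_self, Pi.one_apply]
      have : (∀ c ∈ S, ρ * (a - d) < Function.update ξ .source a c) ↔
          ∀ c ∈ S, ρ * (a - d) < ξ c :=
        forall₂_congr fun c hc => by
          rw [Function.update_of_ne (by rintro rfl; exact hS hc)]
      simp only [this]
    simp_rw [h1]
    rw [lintegral_indicator_one (.pi S.countable_toSet fun _ _ => measurableSet_Ioi),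
      Measure.infinitePi_pi _ fun _ _ => measurableSet_Ioi]
    simp_rw [fun c : Clock n => expMeasure_Ioi (Clock.rate_pos (lamE := lamE) (lam := lam) c)]
    rw [← ENNReal.ofReal_prod_of_nonneg fun _ _ => (Real.exp_pos _).le, ← Real.exp_sum,
      ← ENNReal.ofReal_add (Real.exp_pos _).le (by positivity)]
    refine ENNReal.ofReal_le_ofReal (le_trans (Real.exp_le_exp.2 ?_) (exp_neg_max_le hl' hd))
    rw [Finset.sum_neg_distrib, ← Finset.sum_mul, neg_le_neg_iff,
      show max (ρ * (a - d)) 0 = ρ * max (a - d) 0 by rw [mul_max_of_nonneg _ _ hρ.le, mul_zero],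
      ← mul_assoc, mul_comm _ ρ]
    exact mul_le_mul_of_nonneg_right hrate (le_max_right _ _)
  calc _ ≤ ∫⁻ a, (ENNReal.ofReal (Real.exp (-(lam * a))) + ENNReal.ofReal (lam * d))
        ∂(expMeasure lamE) :=
        lintegral_mono hinner
    _ = _ := by
        have := isProbabilityMeasure_expMeasure hE'
        rw [lintegral_add_right _ measurable_const, lintegral_exp_neg_expMeasure hE' hl',
          lintegral_const, measure_univ, mul_one,
          ← ENNReal.ofReal_add (by positivity) (by positivity)]

end ClockLaw

/-! ### The ages at the self-updates of the source -/

section Epochs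

variable {n : ℕ} {B C : ℝ}

/-- The minimal age in the network. -/
noncomputable def minAge (x : Fin n → ℕ) : ℕ := ⨅ j, x j

lemma minAge_le (x : Fin n → ℕ) (i : Fin n) : minAge x ≤ x i :=
  ciInf_le (OrderBot.bddBelow _) i

lemma eq_minAge_of_mem_minNodes {x : Fin n → ℕ} {j : Fin n} (hj : j ∈ minNodes x) :
    x j = minAge x := by
  have : Nonempty (Fin n) := ⟨j⟩
  exact le_antisymm (le_ciInf (by simpa [minNodes] using hj)) (minAge_le x j)

/-- The ages after a self-update of the source, if `x` are the ages after the previous one. -/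
noncomputable def epochStep (B C : ℝ) (x : Fin n → ℕ) (ξ : Clock n → ℝ) : Fin n → ℕ :=
  fun i => agesWithin B C x ξ (ξ .source) i + 1

lemma agesAtEpoch_succ (ω : Noise n) (k : ℕ) :
    agesAtEpoch B C ω (k + 1) = epochStep B C (agesAtEpoch B C ω k) (ω k) := rfl

lemma epochStep_le (x : Fin n → ℕ) (ξ : Clock n → ℝ) (i : Fin n) :
    epochStep B C x ξ i ≤ x i + 1 :=
  Nat.succ_le_succ (agesWithin_le _ i)

lemma agesAtEpoch_le (ω : Noise n) (k : ℕ) (i : Fin n) : agesAtEpoch B C ω k i ≤ k := by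
  induction k with
  | zero => exact le_rfl
  | succ k ih => exact (epochStep_le _ _ i).trans (Nat.succ_le_succ ih)

lemma agesAtEpoch_congr {ω ω' : Noise n} {k : ℕ} (h : ∀ j < k, ω j = ω' j) :
    agesAtEpoch B C ω k = agesAtEpoch B C ω' k := by
  induction k with
  | zero => rfl
  | succ k ih =>
    rw [agesAtEpoch_succ, agesAtEpoch_succ, ih fun j hj => h j (by omega), h k (by omega)]

lemma epochStep_eq_one_of_update (hn : 2 ≤ n) (hB : 0 < B) (hC : 0 ≤ C) {ξ : Clock n → ℝ}
    (hξ : IsRegular ξ) (x : Fin n → ℕ) {i : Fin n} (hi : ξ (.update i 0) ≤ ξ .source) :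
    epochStep B C x ξ i = 1 := by
  have : ξ (.update i 0) ∈ updateTimes ξ i := ⟨0, by simp⟩
  simp [epochStep, agesWithin_eq_zero_of_update hn hB hC hξ this hi]

lemma epochStep_le_of_gossip (hn : 2 ≤ n) (hB : 0 < B) (hC : 0 ≤ C) {ξ : Clock n → ℝ}
    (hξ : IsRegular ξ) {x : Fin n → ℕ} {i j : Fin n} (hj : j ∈ minNodes x) (hji : j ≠ i)
    (h : ξ (.gossip j i 0) ≤ gossipRate B x * (ξ .source - C * minAge x)) :
    epochStep B C x ξ i ≤ minAge x + 1 := by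
  have hρ := gossipRate_pos hn hB x
  rw [← eq_minAge_of_mem_minNodes hj] at h ⊢
  have hu : C * x j + ξ (.gossip j i 0) / gossipRate B x ∈ gossipTimes B C x ξ j i :=
    ⟨hj, hji, 0, by simp⟩
  have hle : ξ (.gossip j i 0) / gossipRate B x ≤ ξ .source - C * x j := by
    rw [div_le_iff₀ hρ, mul_comm]; exact h
  exact Nat.succ_le_succ (agesWithin_le_of_gossip hn hB hC hξ hu (by linarith))

end Epochs

/-! ### Moment recursions -/

section Moments

variable {n : ℕ} {B C lamE lam : ℝ} [hE : Fact (0 < lamE)] [hl : Fact (0 < lam)]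

lemma integrable_comp_agesAtEpoch (f : (Fin n → ℕ) → ℝ) (k : ℕ) :
    Integrable (fun ω => f (agesAtEpoch B C ω k)) (noiseLaw n lamE lam) := by
  have hfin : (f '' {x | ∀ i, x i ≤ k}).Finite := by
    refine Set.Finite.image f ((Set.Finite.pi' fun _ : Fin n => Set.finite_Iic k).subset ?_)
    exact fun x hx i => hx i
  obtain ⟨b, hb⟩ := (Metric.isBounded_iff_subset_closedBall 0).1 hfin.isBounded
  refine Integrable.of_bound (C := b)
    ((Measurable.of_discrete (f := f)).comp (measurable_agesAtEpoch k)).aestronglyMeasurable ?_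
  refine Eventually.of_forall fun ω => ?_
  have := hb ⟨agesAtEpoch B C ω k, fun i => agesAtEpoch_le ω k i, rfl⟩
  simpa using this

/-- A drift bound for one interval gives a bound for the means at consecutive self-updates. -/
lemma integral_agesAtEpoch_succ_le {Φ Ψ : (Fin n → ℕ) → ℝ} (hΦ : ∀ x, 0 ≤ Φ x)
    (hΨ : ∀ x, 0 ≤ Ψ x)
    (h : ∀ x, ∫⁻ ξ, ENNReal.ofReal (Φ (epochStep B C x ξ)) ∂(clockLaw n lamE lam) ≤
      ENNReal.ofReal (Ψ x)) (k : ℕ) :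
    ∫ ω, Φ (agesAtEpoch B C ω (k + 1)) ∂(noiseLaw n lamE lam) ≤
      ∫ ω, Ψ (agesAtEpoch B C ω k) ∂(noiseLaw n lamE lam) := by
  have hm : Measurable fun ω : Noise n => ENNReal.ofReal (Φ (agesAtEpoch B C ω (k + 1))) :=
    ((Measurable.of_discrete (f := Φ)).comp (measurable_agesAtEpoch _)).ennreal_ofReal
  rw [← ENNReal.ofReal_le_ofReal_iff (integral_nonneg fun _ => hΨ _),
    ofReal_integral_eq_lintegral_ofReal (integrable_comp_agesAtEpoch Φ _)
      (Eventually.of_forall fun _ => hΦ _),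
    ofReal_integral_eq_lintegral_ofReal (integrable_comp_agesAtEpoch Ψ _)
      (Eventually.of_forall fun _ => hΨ _), noiseLaw_eq,
    lintegral_infinitePi_update (fun _ : ℕ => clockLaw n lamE lam) k hm]
  refine lintegral_mono fun ω => le_trans (le_of_eq ?_) (h (agesAtEpoch B C ω k))
  refine lintegral_congr fun ξ => ?_
  rw [agesAtEpoch_succ, Function.update_self,
    agesAtEpoch_congr (ω' := ω) fun j hj => Function.update_of_ne hj.ne _ _]

lemma lintegral_ofReal_le_of_indicator {α : Type*} [MeasurableSpace α] {μ : Measure α}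
    [IsProbabilityMeasure μ] {U : Set α} {f : α → ℝ} {a b q : ℝ} (ha : 0 ≤ a) (hb : 0 ≤ b)
    (hq : 0 ≤ q) (hU : MeasurableSet U) (hUq : μ U ≤ ENNReal.ofReal q)
    (hin : ∀ᵐ y ∂μ, f y ≤ a + b) (hout : ∀ᵐ y ∂μ, y ∉ U → f y ≤ a) :
    ∫⁻ y, ENNReal.ofReal (f y) ∂μ ≤ ENNReal.ofReal (a + b * q) := by
  calc _ ≤ ∫⁻ y, (ENNReal.ofReal a + U.indicator (fun _ => ENNReal.ofReal b) y) ∂μ := by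
        refine lintegral_mono_ae ?_
        filter_upwards [hin, hout] with y h1 h2
        by_cases hy : y ∈ U
        · rw [Set.indicator_of_mem hy, ← ENNReal.ofReal_add ha hb]
          exact ENNReal.ofReal_le_ofReal h1
        · rw [Set.indicator_of_notMem hy, add_zero]
          exact ENNReal.ofReal_le_ofReal (h2 hy)
    _ = ENNReal.ofReal a + ENNReal.ofReal b * μ U := by
        rw [lintegral_add_left measurable_const, lintegral_indicator_const hU]
        simp
    _ ≤ _ := by
        rw [ENNReal.ofReal_add ha (by positivity), ENNReal.ofReal_mul hb]
        gcongr

/-- No node receives an update from the source in the interval. -/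
def noUpdate (n : ℕ) : Set (Clock n → ℝ) := {ξ | ∀ i, ξ .source < ξ (.update i 0)}

lemma measurableSet_noUpdate : MeasurableSet (noUpdate n) := by
  simp only [noUpdate, Set.ofPred_forall]
  exact MeasurableSet.iInter fun i => measurableSet_lt (by fun_prop) (by fun_prop)

lemma clockLaw_noUpdate_le (hn : 2 ≤ n) :
    clockLaw n lamE lam (noUpdate n) ≤ ENNReal.ofReal (lamE / (lamE + lam)) := by
  classical
  have hinj : Function.Injective fun i : Fin n => Clock.update i 0 := fun i j h => by simpa using h
  have hn0 : (n : ℝ) ≠ 0 := by positivity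
  have h := clockLaw_forall_lt_le (lamE := lamE) (lam := lam)
    (Finset.univ.image fun i : Fin n => Clock.update i 0) (by simp) one_pos le_rfl (by
      rw [Finset.sum_image hinj.injOn]
      simp [Clock.rate, mul_div_cancel₀ lam hn0])
  simpa [noUpdate] using h

/-- No gossip stream from a node of minimal age to `i` starts before the end of the interval. The clock
from `i` to itself is included, although it has no effect, so that the total rate does not depend on
whether `i` is of minimal age. -/
def noGossip (B C : ℝ) (x : Fin n → ℕ) (i : Fin n) : Set (Clock n → ℝ) :=
  {ξ | ∀ j ∈ minNodes x, gossipRate B x * (ξ .source - C * minAge x) < ξ (.gossip j i 0)}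

lemma measurableSet_noGossip (x : Fin n → ℕ) (i : Fin n) :
    MeasurableSet (noGossip B C x i) := by
  simp only [noGossip, Set.ofPred_forall]
  exact MeasurableSet.biInter (minNodes x).countable_toSet fun i _ =>
    measurableSet_lt (by fun_prop) (by fun_prop)

lemma clockLaw_noGossip_le (hn : 2 ≤ n) (hC : 0 ≤ C) (x : Fin n → ℕ) (i : Fin n) :
    clockLaw n lamE lam (noGossip (n * lam) C x i) ≤
      ENNReal.ofReal (lamE / (lamE + lam) + lam * (C * minAge x)) := by
  classical
  have hl' := hl.out
  have hinj : Function.Injective fun j : Fin n => Clock.gossip j i 0 := fun i j h => by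
    simpa using h
  have hn2 : (2 : ℝ) ≤ n := by exact_mod_cast hn
  have hcard : (0 : ℝ) < (minNodes x).card := by
    exact_mod_cast (minNodes_nonempty (by omega) x).card_pos
  have h := clockLaw_forall_lt_le (lamE := lamE) (lam := lam)
    ((minNodes x).image fun j : Fin n => Clock.gossip j i 0) (by simp)
    (gossipRate_pos hn (B := n * lam) (by positivity) x)
    (d := C * minAge x) (by positivity) (by
      rw [Finset.sum_image hinj.injOn]
      simp only [Clock.rate, Finset.sum_const, nsmul_eq_mul, mul_one, gossipRate]
      rw [show (n : ℝ) * lam / ((minNodes x).card * (n - 1)) * (minNodes x).card =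
        n * lam / (n - 1) by
          have : (n : ℝ) - 1 ≠ 0 := by linarith
          field_simp, le_div_iff₀ (by linarith)]
      nlinarith)
  simpa [noGossip] using h

lemma ae_minAge_epochStep_le (hn : 2 ≤ n) (hB : 0 < B) (hC : 0 ≤ C) (x : Fin n → ℕ) :
    ∀ᵐ ξ ∂(clockLaw n lamE lam), ξ ∉ noUpdate n → minAge (epochStep B C x ξ) ≤ 1 := by
  filter_upwards [ae_isRegular] with ξ hξ hU
  simp only [noUpdate, Set.mem_ofPred_eq, not_forall, not_lt] at hU
  obtain ⟨i, hi⟩ := hU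
  exact (minAge_le _ i).trans_eq (epochStep_eq_one_of_update hn hB hC hξ x hi)

lemma minAge_epochStep_le (hn : 2 ≤ n) (x : Fin n → ℕ) (ξ : Clock n → ℝ) :
    minAge (epochStep B C x ξ) ≤ minAge x + 1 := by
  obtain ⟨j, hj⟩ := minNodes_nonempty (by omega) x
  rw [← eq_minAge_of_mem_minNodes hj]
  exact (minAge_le _ j).trans (epochStep_le x ξ j)

lemma lintegral_minAge_epochStep_le (hn : 2 ≤ n) (hB : 0 < B) (hC : 0 ≤ C) (x : Fin n → ℕ) :
    ∫⁻ ξ, ENNReal.ofReal (minAge (epochStep B C x ξ)) ∂(clockLaw n lamE lam) ≤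
      ENNReal.ofReal (1 + lamE / (lamE + lam) * minAge x) := by
  have hE' := hE.out
  have hl' := hl.out
  rw [mul_comm]
  refine lintegral_ofReal_le_of_indicator zero_le_one (by positivity) (by positivity)
    measurableSet_noUpdate (clockLaw_noUpdate_le hn) (Eventually.of_forall fun ξ => ?_) ?_
  · have := minAge_epochStep_le (B := B) (C := C) hn x ξ
    rw [add_comm]
    exact_mod_cast this
  · filter_upwards [ae_minAge_epochStep_le (lamE := lamE) (lam := lam) hn hB hC x] with ξ hξ hU
    exact_mod_cast hξ hU

lemma lintegral_mul_minAge_epochStep_le (hn : 2 ≤ n) (hB : 0 < B) (hC : 0 ≤ C) (i : Fin n)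
    (x : Fin n → ℕ) :
    ∫⁻ ξ, ENNReal.ofReal (epochStep B C x ξ i * minAge (epochStep B C x ξ))
        ∂(clockLaw n lamE lam) ≤
      ENNReal.ofReal (1 + x i + lamE / (lamE + lam) * minAge x +
        lamE / (lamE + lam) * (x i * minAge x)) := by
  have hE' := hE.out
  have hl' := hl.out
  have hstep : ∀ ξ, (epochStep B C x ξ i : ℝ) ≤ x i + 1 := fun ξ => by
    exact_mod_cast epochStep_le x ξ i
  rw [show (1 : ℝ) + x i + lamE / (lamE + lam) * minAge x +
      lamE / (lamE + lam) * (x i * minAge x) =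
    (x i + 1) + ((x i + 1) * minAge x) * (lamE / (lamE + lam)) by ring]
  refine lintegral_ofReal_le_of_indicator (by positivity) (by positivity) (by positivity)
    measurableSet_noUpdate (clockLaw_noUpdate_le hn) (Eventually.of_forall fun ξ => ?_) ?_
  · have h2 : (minAge (epochStep B C x ξ) : ℝ) ≤ minAge x + 1 := by
      exact_mod_cast minAge_epochStep_le (B := B) (C := C) hn x ξ
    calc _ ≤ ((x i : ℝ) + 1) * (minAge x + 1) :=
          mul_le_mul (hstep ξ) h2 (by positivity) (by positivity)
      _ = _ := by ring
  · filter_upwards [ae_minAge_epochStep_le (lamE := lamE) (lam := lam) hn hB hC x] with ξ hξ hU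
    have h2 : (minAge (epochStep B C x ξ) : ℝ) ≤ 1 := by exact_mod_cast hξ hU
    calc _ ≤ ((x i : ℝ) + 1) * 1 :=
          mul_le_mul (hstep ξ) h2 (by positivity) (by positivity)
      _ = _ := by ring

lemma lintegral_epochStep_le (hn : 2 ≤ n) (hC : 0 ≤ C) (i : Fin n) (x : Fin n → ℕ) :
    ∫⁻ ξ, ENNReal.ofReal (epochStep (n * lam) C x ξ i) ∂(clockLaw n lamE lam) ≤
      ENNReal.ofReal (1 + lam / (lamE + lam) * minAge x + lamE / (lamE + lam) * x i +
        lam * C * (x i * minAge x)) := by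
  have hE' := hE.out
  have hl' := hl.out
  have hB : (0 : ℝ) < n * lam := by positivity
  have hmx : (minAge x : ℝ) ≤ x i := by exact_mod_cast minAge_le x i
  have hp : lam / (lamE + lam) = 1 - lamE / (lamE + lam) := by field_simp; ring
  have hq : 0 ≤ lamE / (lamE + lam) := by positivity
  refine le_trans (lintegral_ofReal_le_of_indicator (a := minAge x + 1) (b := x i - minAge x)
    (by positivity) (by linarith) (by positivity) (measurableSet_noGossip x i)
    (clockLaw_noGossip_le hn hC x i) (Eventually.of_forall fun ξ => ?_) ?_)
    (ENNReal.ofReal_le_ofReal ?_)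
  · have : (epochStep (n * lam) C x ξ i : ℝ) ≤ x i + 1 := by exact_mod_cast epochStep_le x ξ i
    linarith
  · filter_upwards [ae_isRegular (lamE := lamE) (lam := lam)] with ξ hξ hG
    simp only [noGossip, Set.mem_ofPred_eq, not_forall, not_lt] at hG
    obtain ⟨j, hj, hji⟩ := hG
    by_cases h : j = i
    · subst h
      have := epochStep_le (B := n * lam) (C := C) x ξ j
      rw [eq_minAge_of_mem_minNodes hj] at this
      exact_mod_cast this
    · exact_mod_cast epochStep_le_of_gossip hn hB hC hξ hj h hji
  · rw [hp]
    have : 0 ≤ lam * C * minAge x * minAge x := by positivity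
    nlinarith

lemma integral_affine {α : Type*} [MeasurableSpace α] {μ : Measure α} [IsProbabilityMeasure μ]
    {f g h : α → ℝ} (a b c : ℝ) (hf : Integrable f μ) (hg : Integrable g μ) (hh : Integrable h μ) :
    ∫ y, (1 + a * f y + b * g y + c * h y) ∂μ =
      1 + a * ∫ y, f y ∂μ + b * ∫ y, g y ∂μ + c * ∫ y, h y ∂μ := by
  have i1 : Integrable (fun _ : α => (1 : ℝ)) μ := integrable_const _
  have i2 : Integrable (fun y => 1 + a * f y) μ := i1.add (hf.const_mul a)
  have i3 : Integrable (fun y => 1 + a * f y + b * g y) μ := i2.add (hg.const_mul b)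
  rw [integral_add i3 (hh.const_mul c), integral_add i2 (hg.const_mul b),
    integral_add i1 (hf.const_mul a), integral_const_mul, integral_const_mul, integral_const_mul]
  simp

/-- The bound for `E [x i * minAge x]` that goes with the bound `2 * (lamE + lam) / lam + ε` for
`E [x i]`. -/
noncomputable def crossMomentBound (lamE lam ε : ℝ) : ℝ :=
  (1 + (2 * ((lamE + lam) / lam) + ε) + lamE / lam) * ((lamE + lam) / lam)

/-- If the back-off constant is small, the mean ages at the self-updates of the source are almost
bounded by the value for back-off constant zero, uniformly in time and in the size of the
network. -/
lemma integral_agesAtEpoch_le (hn : 2 ≤ n) (hC : 0 ≤ C) {ε : ℝ} (hε : 0 ≤ ε)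
    (hCε : lam * C * crossMomentBound lamE lam ε ≤ lam / (lamE + lam) * ε) (i : Fin n) (k : ℕ) :
    ∫ ω, (agesAtEpoch (n * lam) C ω k i : ℝ) ∂(noiseLaw n lamE lam) ≤
      2 * ((lamE + lam) / lam) + ε := by
  have hE' := hE.out
  have hl' := hl.out
  have hB : (0 : ℝ) < n * lam := by positivity
  suffices h : (∫ ω, (minAge (agesAtEpoch (n * lam) C ω k) : ℝ) ∂(noiseLaw n lamE lam) ≤
        (lamE + lam) / lam) ∧
      (∫ ω, (agesAtEpoch (n * lam) C ω k i : ℝ) ∂(noiseLaw n lamE lam) ≤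
        2 * ((lamE + lam) / lam) + ε) ∧
      (∫ ω, (agesAtEpoch (n * lam) C ω k i : ℝ) * minAge (agesAtEpoch (n * lam) C ω k)
        ∂(noiseLaw n lamE lam) ≤ crossMomentBound lamE lam ε) from h.2.1
  have hint := fun (f : (Fin n → ℕ) → ℝ) k =>
    integrable_comp_agesAtEpoch (B := n * lam) (C := C) (lamE := lamE) (lam := lam) f k
  induction k with
  | zero =>
    have h0 : minAge (fun _ : Fin n => 0) = 0 := Nat.le_zero.1 (minAge_le _ i)
    simp only [agesAtEpoch, h0, Nat.cast_zero, mul_zero, integral_zero]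
    refine ⟨by positivity, by positivity, ?_⟩
    unfold crossMomentBound
    positivity
  | succ k ih =>
    obtain ⟨ihM, ihX, ihY⟩ := ih
    have hM := integral_agesAtEpoch_succ_le (lamE := lamE) (lam := lam)
      (Φ := fun x => (minAge x : ℝ)) (fun _ => by positivity) (fun _ => by positivity)
      (lintegral_minAge_epochStep_le (B := n * lam) hn hB hC) k
    have hX := integral_agesAtEpoch_succ_le (lamE := lamE) (lam := lam)
      (Φ := fun x => (x i : ℝ)) (fun _ => by positivity) (fun _ => by positivity)
      (lintegral_epochStep_le hn hC i) k
    have hY := integral_agesAtEpoch_succ_le (lamE := lamE) (lam := lam)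
      (Φ := fun x => (x i : ℝ) * minAge x) (fun _ => by positivity) (fun _ => by positivity)
      (lintegral_mul_minAge_epochStep_le (B := n * lam) hn hB hC i) k
    have im := hint (fun x => (minAge x : ℝ)) k
    have ix := hint (fun x => (x i : ℝ)) k
    have iy := hint (fun x => (x i : ℝ) * minAge x) k
    have hM' := integral_affine (lamE / (lamE + lam)) 0 0 im ix iy
    have hX' := integral_affine (lam / (lamE + lam)) (lamE / (lamE + lam)) (lam * C) im ix iy
    have hY' := integral_affine 1 (lamE / (lamE + lam)) (lamE / (lamE + lam)) ix im iy
    simp only [zero_mul, add_zero, one_mul] at hM' hY'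
    rw [hM'] at hM
    rw [hX'] at hX
    rw [hY'] at hY
    have hp : 0 ≤ lamE / (lamE + lam) := by positivity
    have hp' : 0 ≤ lam / (lamE + lam) := by positivity
    have hlC : 0 ≤ lam * C := by positivity
    refine ⟨hM.trans ?_, hX.trans ?_, hY.trans ?_⟩
    · have h1 := mul_le_mul_of_nonneg_left ihM hp
      have h2 : 1 + lamE / (lamE + lam) * ((lamE + lam) / lam) = (lamE + lam) / lam := by
        field_simp; ring
      linarith
    · have h1 := mul_le_mul_of_nonneg_left ihM hp'
      have h2 := mul_le_mul_of_nonneg_left ihX hp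
      have h3 := mul_le_mul_of_nonneg_left ihY hlC
      have h4 : 1 + lam / (lamE + lam) * ((lamE + lam) / lam) +
          lamE / (lamE + lam) * (2 * ((lamE + lam) / lam) + ε) + lam / (lamE + lam) * ε =
          2 * ((lamE + lam) / lam) + ε := by
        field_simp; ring
      linarith
    · have h1 := mul_le_mul_of_nonneg_left ihM hp
      have h3 := mul_le_mul_of_nonneg_left ihY hp
      have h4 : 1 + (2 * ((lamE + lam) / lam) + ε) +
          lamE / (lamE + lam) * ((lamE + lam) / lam) +
          lamE / (lamE + lam) * crossMomentBound lamE lam ε = crossMomentBound lamE lam ε := by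
        unfold crossMomentBound; field_simp; ring
      linarith

end Moments

/-! ### Reversing the order of the intervals -/

section Reversal

variable {n : ℕ} {B C : ℝ}

/-- The permutation of `ℕ` that reverses `0, …, k` and fixes all other numbers. -/
def revPerm (k : ℕ) : Equiv.Perm ℕ :=
  Function.Involutive.toPerm (fun j => if j ≤ k then k - j else j) fun j => by
    dsimp only; split_ifs <;> omega

lemma revPerm_of_le {j k : ℕ} (h : j ≤ k) : revPerm k j = k - j := if_pos h

lemma revPerm_revPerm (k j : ℕ) : revPerm k (revPerm k j) = j :=
  (revPerm k).left_inv j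

/-- The noise with the intervals `0, …, k` in reversed order. -/
def reverse (k : ℕ) (ω : Noise n) : Noise n := fun j => ω (revPerm k j)

lemma reverse_apply {j k : ℕ} (h : j ≤ k) (ω : Noise n) : reverse k ω j = ω (k - j) := by
  rw [reverse, revPerm_of_le h]

lemma reverse_reverse (k : ℕ) (ω : Noise n) : reverse k (reverse k ω) = ω :=
  funext fun j => congrArg ω (revPerm_revPerm k j)

@[fun_prop]
lemma measurable_reverse (k : ℕ) : Measurable (reverse k : Noise n → Noise n) := by
  unfold reverse
  fun_prop

/-- The age of node `i` at the end of interval `0`, if the intervals `k, k - 1, …, 0` are passed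
through in this order, starting with all ages zero. -/
noncomputable def backwardAge (B C : ℝ) (i : Fin n) (k : ℕ) (ω : Noise n) : ℕ :=
  agesAtEpoch B C (reverse k ω) (k + 1) i - 1

lemma agesAtEpoch_succ_eq (ω : Noise n) (k : ℕ) (i : Fin n) :
    agesAtEpoch B C ω (k + 1) i =
      agesWithin B C (agesAtEpoch B C ω k) (ω k) (ω k .source) i + 1 := rfl

lemma agesAtEpoch_reverse_succ (ω : Noise n) (k : ℕ) (i : Fin n) :
    agesAtEpoch B C (reverse k ω) (k + 1) i = backwardAge B C i k ω + 1 := by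
  simp [backwardAge, agesAtEpoch_succ_eq]

lemma backwardAge_reverse (ω : Noise n) (k : ℕ) (i : Fin n) :
    backwardAge B C i k (reverse k ω) =
      agesWithin B C (agesAtEpoch B C ω k) (ω k) (ω k .source) i := by
  simp [backwardAge, reverse_reverse, agesAtEpoch_succ_eq]

lemma backwardAge_le (i : Fin n) (k : ℕ) (ω : Noise n) : backwardAge B C i k ω ≤ k := by
  have := agesAtEpoch_le (B := B) (C := C) (reverse k ω) (k + 1) i
  unfold backwardAge
  omega

lemma measurable_agesAtEpoch_apply (k : ℕ) (i : Fin n) :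
    Measurable fun ω : Noise n => agesAtEpoch B C ω k i :=
  (measurable_agesAtEpoch k).eval

lemma measurable_backwardAge (i : Fin n) (k : ℕ) :
    Measurable fun ω : Noise n => backwardAge B C i k ω := by
  unfold backwardAge
  exact (measurable_of_countable (fun m : ℕ => m - 1)).comp 
    ((measurable_agesAtEpoch_apply (B := B) (C := C) (k + 1) i).comp (measurable_reverse k))

lemma agesAtEpoch_one (ω : Noise n) : agesAtEpoch B C ω 1 = 1 := by
  funext i
  change agesWithin B C 0 _ _ i + 1 = 1
  rw [agesWithin_zero]
  rfl

/-- The first interval does not influence the ages, because all ages are zero there. -/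
lemma agesAtEpoch_succ_congr {ω ω' : Noise n} {k : ℕ} (h : ∀ j < k, ω (j + 1) = ω' (j + 1)) :
    agesAtEpoch B C ω (k + 1) = agesAtEpoch B C ω' (k + 1) := by
  induction k with
  | zero => rw [agesAtEpoch_one, agesAtEpoch_one]
  | succ k ih =>
    rw [agesAtEpoch_succ ω, agesAtEpoch_succ ω', ih fun j hj => h j (by omega), h k (by omega)]

/-- All nodes are updated by the source in the interval. -/
def allUpdated (n : ℕ) : Set (Clock n → ℝ) := {ξ | ∀ i, ξ (.update i 0) ≤ ξ .source}

/-- After an interval in which all nodes are updated by the source, the past is forgotten. Hence the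
backward process is constant from the first such interval on. -/
lemma backwardAge_eq_of_allUpdated (hn : 2 ≤ n) (hB : 0 < B) (hC : 0 ≤ C) (i : Fin n)
    {ω : Noise n} {j k : ℕ} (hreg : IsRegular (ω j)) (hj : ω j ∈ allUpdated n) (hjk : j ≤ k) :
    backwardAge B C i k ω = backwardAge B C i j ω := by
  have key : ∀ l ≤ j, agesAtEpoch B C (reverse k ω) (k - j + 1 + l) =
      agesAtEpoch B C (reverse j ω) (1 + l) := by
    intro l
    induction l with
    | zero =>
      intro _
      rw [add_zero, add_zero, agesAtEpoch_one, agesAtEpoch_succ, reverse_apply (by omega),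
        show k - (k - j) = j by omega]
      exact funext fun i => epochStep_eq_one_of_update hn hB hC hreg _ (hj i)
    | succ l ih =>
      intro hl
      rw [← add_assoc, ← add_assoc, agesAtEpoch_succ, agesAtEpoch_succ, ih (by omega),
        reverse_apply (by omega), reverse_apply (by omega)]
      congr 2
      omega
  have h := key j le_rfl
  rw [show k - j + 1 + j = k + 1 by omega, add_comm 1 j] at h
  rw [backwardAge, backwardAge, h]

/-- The noise with the length of the interval `j` replaced by `a`. -/
noncomputable def setLength (ω : Noise n) (j : ℕ) (a : ℝ) : Noise n :=
  open Classical in Function.update ω j (Function.update (ω j) .source a)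

lemma setLength_of_ne (ω : Noise n) {j l : ℕ} (a : ℝ) (h : l ≠ j) : setLength ω j a l = ω l := by
  classical exact Function.update_of_ne h _ _

lemma setLength_source (ω : Noise n) (j : ℕ) (a : ℝ) : setLength ω j a j .source = a := by
  simp [setLength]

lemma agesWithin_setLength (x : Fin n → ℕ) (ω : Noise n) (j : ℕ) (a s : ℝ) :
    agesWithin B C x (setLength ω j a j) s = agesWithin B C x (ω j) s := by
  classical
  rw [setLength, Function.update_self, agesWithin_update_source]

lemma measurable_setLength (j : ℕ) :
    Measurable fun p : Noise n × ℝ => setLength p.1 j p.2 := by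
  classical
  have h1 : Measurable fun p : Noise n × ℝ => Function.update (p.1 j) (.source : Clock n) p.2 :=
    (measurable_update_prod (X := fun _ : Clock n => ℝ) .source).comp
      (Measurable.prodMk (by fun_prop) measurable_snd)
  exact (measurable_update_prod (X := fun _ : ℕ => Clock n → ℝ) j).comp
    (measurable_fst.prodMk h1)

lemma updateEpoch_succ (ω : Noise n) (k : ℕ) :
    updateEpoch ω (k + 1) = updateEpoch ω k + ω k .source := Finset.sum_range_succ _ _

lemma updateEpoch_succ' (ω : Noise n) (k : ℕ) :
    updateEpoch ω (k + 1) = ∑ q ∈ Finset.range k, ω (q + 1) .source + ω 0 .source :=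
  Finset.sum_range_succ' _ _

lemma updateEpoch_reverse (ω : Noise n) (k : ℕ) :
    updateEpoch (reverse k ω) k = ∑ q ∈ Finset.range k, ω (q + 1) .source := by
  rw [updateEpoch, ← Finset.sum_range_reflect]
  refine Finset.sum_congr rfl fun q hq => ?_
  have := Finset.mem_range.1 hq
  rw [reverse_apply (by omega), show k - (k - 1 - q) = q + 1 by omega]

lemma updateEpoch_reverse_succ (ω : Noise n) (k : ℕ) :
    updateEpoch (reverse k ω) (k + 1) = updateEpoch ω (k + 1) := by
  rw [updateEpoch_succ, updateEpoch_reverse, updateEpoch_succ', reverse_apply le_rfl, Nat.sub_self]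

variable {lamE lam : ℝ} [hE : Fact (0 < lamE)] [hl : Fact (0 < lam)]

lemma measurePreserving_reverse (k : ℕ) :
    MeasurePreserving (reverse k) (noiseLaw n lamE lam) (noiseLaw n lamE lam) := by
  refine ⟨measurable_reverse k, ?_⟩
  have h := Measure.infinitePi_map_piCongrLeft (fun _ : ℕ => clockLaw n lamE lam) (revPerm k)
  rw [← noiseLaw_eq] at h
  have hrev : ⇑(MeasurableEquiv.piCongrLeft (fun _ : ℕ => Clock n → ℝ) (revPerm k)) =
      reverse k := by
    ext ω j : 2
    obtain ⟨l, rfl⟩ := (revPerm k).surjective j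
    rw [MeasurableEquiv.coe_piCongrLeft, Equiv.piCongrLeft_apply_apply, reverse, revPerm_revPerm]
  rwa [hrev] at h

lemma lintegral_setLength (j : ℕ) {f : Noise n → ℝ≥0∞} (hf : Measurable f) :
    ∫⁻ ω, f ω ∂(noiseLaw n lamE lam) =
      ∫⁻ ω, ∫⁻ a, f (setLength ω j a) ∂(expMeasure lamE) ∂(noiseLaw n lamE lam) := by
  classical
  have := isProbabilityMeasure_expMeasure hE.out
  have hg : Measurable fun ω : Noise n => ∫⁻ a, f (setLength ω j a) ∂(expMeasure lamE) :=
    (hf.comp (measurable_setLength j)).lintegral_prod_right'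
  rw [noiseLaw_eq, lintegral_infinitePi_update _ j hf, lintegral_infinitePi_update _ j hg]
  refine lintegral_congr fun ω => ?_
  have hfω : Measurable fun ξ => f (Function.update ω j ξ) :=
    hf.comp (measurable_update ω)
  rw [clockLaw, lintegral_infinitePi_update _ .source hfω]
  simp [setLength, Clock.rate]

/-- The source updates itself exactly `k` times up to time `t`. -/
def epochEvent (n : ℕ) (t : ℝ) (k : ℕ) : Set (Noise n) :=
  {ω | updateEpoch ω k ≤ t ∧ t < updateEpoch ω (k + 1)}

lemma measurableSet_epochEvent (t : ℝ) (k : ℕ) : MeasurableSet (epochEvent n t k) :=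
  (measurableSet_le (measurable_updateEpoch k) measurable_const).inter
    (measurableSet_lt measurable_const (measurable_updateEpoch (k + 1)))

lemma measurable_agesWithin_epoch (k : ℕ) (i : Fin n) {s : Noise n → ℝ} (hs : Measurable s) :
    Measurable fun ω : Noise n => agesWithin B C (agesAtEpoch B C ω k) (ω k) (s ω) i :=
  (measurable_pi_apply i).comp (measurable_agesWithin.comp
    ((measurable_agesAtEpoch k).prodMk (Measurable.prodMk (by fun_prop) hs)))

/-- Seen from time `t` backwards, the gaps between the self-updates of the source look like the gaps
seen from time `0` forwards. Hence the age at time `t` is distributed as the backward age. -/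
lemma lintegral_epochEvent_age (i : Fin n) (t : ℝ) (k : ℕ) :
    ∫⁻ ω, (epochEvent n t k).indicator (fun ω =>
        (agesWithin B C (agesAtEpoch B C ω k) (ω k) (t - updateEpoch ω k) i : ℝ≥0∞)) ω
        ∂(noiseLaw n lamE lam) =
      ∫⁻ ω, (epochEvent n t k).indicator (fun ω => (backwardAge B C i k ω : ℝ≥0∞)) ω
        ∂(noiseLaw n lamE lam) := by
  have hcast : Measurable fun m : ℕ => (m : ℝ≥0∞) := measurable_of_countable _
  rcases k with _ | k
  · have h1 : ∀ ω : Noise n, agesWithin B C (agesAtEpoch B C ω 0) (ω 0)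
        (t - updateEpoch ω 0) i = 0 := fun ω => congrFun (agesWithin_zero _) i
    have h2 : ∀ ω : Noise n, backwardAge B C i 0 ω = 0 := fun ω =>
      Nat.le_zero.1 (backwardAge_le i 0 ω)
    simp only [h1, h2]
  · have hmB : Measurable fun ω : Noise n => (epochEvent n t (k + 1)).indicator
        (fun ω => (backwardAge B C i (k + 1) ω : ℝ≥0∞)) ω :=
      (hcast.comp (measurable_backwardAge i _)).indicator (measurableSet_epochEvent t _)
    have hmF : Measurable fun ω : Noise n => (epochEvent n t (k + 1)).indicator (fun ω =>
        (agesWithin B C (agesAtEpoch B C ω (k + 1)) (ω (k + 1))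
          (t - updateEpoch ω (k + 1)) i : ℝ≥0∞)) ω :=
      (hcast.comp (measurable_agesWithin_epoch _ i (measurable_const.sub
        (measurable_updateEpoch _)))).indicator (measurableSet_epochEvent t _)
    rw [← (measurePreserving_reverse (k + 1)).lintegral_comp hmB]
    have hmR : Measurable fun ω : Noise n => (epochEvent n t (k + 1)).indicator
        (fun ω => (backwardAge B C i (k + 1) ω : ℝ≥0∞)) (reverse (k + 1) ω) :=
      hmB.comp (measurable_reverse (k + 1))
    -- resample the lengths of the intervals `0` and `k + 1`
    have hresample : ∀ f : Noise n → ℝ≥0∞, Measurable f → ∫⁻ ω, f ω ∂(noiseLaw n lamE lam) =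
        ∫⁻ ω, ∫⁻ a, ∫⁻ b, f (setLength (setLength ω 0 a) (k + 1) b) ∂(expMeasure lamE)
          ∂(expMeasure lamE) ∂(noiseLaw n lamE lam) := by
      intro f hf
      have := isProbabilityMeasure_expMeasure hE.out
      rw [lintegral_setLength (k + 1) hf, lintegral_setLength 0]
      exact (hf.comp (measurable_setLength (k + 1))).lintegral_prod_right'
    rw [hresample _ hmF, hresample _ hmR]
    refine lintegral_congr fun ω => ?_
    have hh : Measurable fun s : ℝ => (agesWithin B C (agesAtEpoch B C ω (k + 1)) (ω (k + 1)) s i :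
        ℝ≥0∞) :=
      hcast.comp ((measurable_pi_apply i).comp (measurable_agesWithin.comp
        (measurable_const.prodMk (measurable_const.prodMk measurable_id))))
    convert lintegral_expMeasure_age hE.out
      (t - ∑ q ∈ Finset.range k, ω (q + 1) .source) hh using 1
    · refine lintegral_congr fun a => lintegral_congr fun b => ?_
      have hx : agesAtEpoch B C (setLength (setLength ω 0 a) (k + 1) b) (k + 1) =
          agesAtEpoch B C ω (k + 1) := agesAtEpoch_succ_congr fun j hj => by
        rw [setLength_of_ne _ _ (by omega), setLength_of_ne _ _ (by omega)]
      have hT : updateEpoch (setLength (setLength ω 0 a) (k + 1) b) (k + 1) =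
          ∑ q ∈ Finset.range k, ω (q + 1) .source + a := by
        rw [updateEpoch_succ', setLength_of_ne _ _ (by omega), setLength_source]
        congr 1
        refine Finset.sum_congr rfl fun q hq => ?_
        have := Finset.mem_range.1 hq
        rw [setLength_of_ne _ _ (by omega), setLength_of_ne _ _ (by omega)]
      simp only [Set.indicator, epochEvent, Set.mem_ofPred_eq, updateEpoch_succ _ (k + 1), hT,
        setLength_source, hx, agesWithin_setLength, setLength_of_ne ω a (Nat.succ_ne_zero k)]
      congr 1
      · refine propext (and_congr ?_ ?_) <;> constructor <;> intro h <;> linarith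
      · rw [sub_sub]
    · refine lintegral_congr fun a => lintegral_congr fun b => ?_
      have hx : agesAtEpoch B C (setLength (setLength ω 0 a) (k + 1) b) (k + 1) =
          agesAtEpoch B C ω (k + 1) := agesAtEpoch_succ_congr fun j hj => by
        rw [setLength_of_ne _ _ (by omega), setLength_of_ne _ _ (by omega)]
      have hT : ∑ q ∈ Finset.range k,
            setLength (setLength ω 0 a) (k + 1) b (q + 1) .source =
          ∑ q ∈ Finset.range k, ω (q + 1) .source := by
        refine Finset.sum_congr rfl fun q hq => ?_
        have := Finset.mem_range.1 hq
        rw [setLength_of_ne _ _ (by omega), setLength_of_ne _ _ (by omega)]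
      have hT1 : updateEpoch (reverse (k + 1) (setLength (setLength ω 0 a) (k + 1) b)) (k + 1) =
          ∑ q ∈ Finset.range k, ω (q + 1) .source + b := by
        rw [updateEpoch_reverse, Finset.sum_range_succ, hT, setLength_source]
      have hT2 : updateEpoch (reverse (k + 1) (setLength (setLength ω 0 a) (k + 1) b)) (k + 1 + 1) =
          ∑ q ∈ Finset.range k, ω (q + 1) .source + b + a := by
        rw [updateEpoch_reverse_succ, updateEpoch_succ', Finset.sum_range_succ, hT,
          setLength_source, setLength_of_ne _ _ (by omega), setLength_source]
      simp only [Set.indicator, epochEvent, Set.mem_ofPred_eq, hT1, hT2, backwardAge_reverse,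
        setLength_source, hx, agesWithin_setLength, setLength_of_ne ω a (Nat.succ_ne_zero k)]
      congr 1
      refine propext (and_congr ?_ ?_) <;> constructor <;> intro h <;> linarith

end Reversal

/-! ### Convergence of the mean age -/

section Convergence

variable {n : ℕ} {B C lamE lam : ℝ}

lemma strictMono_updateEpoch {ω : Noise n} (hpos : ∀ k, 0 < ω k .source) :
    StrictMono (updateEpoch ω) :=
  strictMono_nat_of_lt_succ fun k => by
    rw [updateEpoch_succ]; linarith [hpos k]

lemma bddAbove_updateEpoch_le {ω : Noise n} (hpos : ∀ k, 0 < ω k .source)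
    (hunb : ∀ R, ∃ k, R < updateEpoch ω k) (t : ℝ) : BddAbove {k | updateEpoch ω k ≤ t} := by
  obtain ⟨K, hK⟩ := hunb t
  refine ⟨K, fun k hk => ?_⟩
  exact ((strictMono_updateEpoch hpos).lt_iff_lt.1 (lt_of_le_of_lt hk hK)).le

lemma mem_epochEvent_sourceVersion {ω : Noise n} (hpos : ∀ k, 0 < ω k .source)
    (hunb : ∀ R, ∃ k, R < updateEpoch ω k) {t : ℝ} (ht : 0 ≤ t) :
    ω ∈ epochEvent n t (sourceVersion ω t) := by
  have hb := bddAbove_updateEpoch_le hpos hunb t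
  refine ⟨Nat.sSup_mem ⟨0, by simpa [updateEpoch] using ht⟩ hb, ?_⟩
  by_contra! h
  have : sourceVersion ω t + 1 ≤ sourceVersion ω t := le_csSup hb h
  omega

lemma eq_sourceVersion_of_mem_epochEvent {ω : Noise n} (hpos : ∀ k, 0 < ω k .source) {t : ℝ} {k : ℕ}
    (h : ω ∈ epochEvent n t k) : sourceVersion ω t = k := by
  refine IsGreatest.csSup_eq ⟨h.1, fun l hl => ?_⟩
  by_contra! hkl
  exact absurd (h.2.trans_le ((strictMono_updateEpoch hpos).monotone hkl)) (not_lt.2 hl)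

lemma tendsto_sourceVersion {ω : Noise n} (hpos : ∀ k, 0 < ω k .source)
    (hunb : ∀ R, ∃ k, R < updateEpoch ω k) :
    Tendsto (fun t => sourceVersion ω t) atTop atTop := by
  refine tendsto_atTop.2 fun k => ?_
  filter_upwards [eventually_ge_atTop (updateEpoch ω k)] with t ht
  exact le_csSup (bddAbove_updateEpoch_le hpos hunb t) ht

variable [hE : Fact (0 < lamE)] [hl : Fact (0 < lam)]

lemma ae_noise_forall {p : (Clock n → ℝ) → Prop} (h : ∀ᵐ ξ ∂(clockLaw n lamE lam), p ξ) :
    ∀ᵐ ω ∂(noiseLaw n lamE lam), ∀ k, p (ω k) :=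
  ae_all_iff.2 fun k => (measurePreserving_eval_infinitePi
    (fun _ : ℕ => clockLaw n lamE lam) k).quasiMeasurePreserving.ae h

lemma ae_updateEpoch_unbounded :
    ∀ᵐ ω ∂(noiseLaw n lamE lam), ∀ R, ∃ k, R < updateEpoch ω k := by
  have hpos := ae_noise_forall (n := n) (ae_clock_pos (lamE := lamE) (lam := lam) .source)
  have hA : MeasurableSet {ξ : Clock n → ℝ | ξ .source < 1} :=
    measurableSet_lt (by fun_prop) measurable_const
  have hmap : clockLaw n lamE lam {ξ | ξ .source < 1} = expMeasure lamE (Set.Iio 1) :=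
    (measurePreserving_eval_infinitePi (fun c : Clock n => expMeasure (c.rate lamE lam))
      .source).measure_preimage measurableSet_Iio.nullMeasurableSet
  filter_upwards [hpos, ae_frequently_notMem_infinitePi (fun _ : ℕ => clockLaw n lamE lam)
    Function.injective_id (fun _ => hA) (expMeasure_Iio_lt_one hE.out 1)
    (fun _ => hmap.le)] with ω h1 h2
  refine exists_lt_sum_of_frequently h1 fun N => ?_
  obtain ⟨q, hq, hne⟩ := h2 N
  exact ⟨q, hq, by simpa using hne⟩

lemma lintegral_versionAge (i : Fin n) {t : ℝ} (ht : 0 ≤ t) :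
    ∫⁻ ω, (versionAge B C ω t i : ℝ≥0∞) ∂(noiseLaw n lamE lam) =
      ∫⁻ ω, (backwardAge B C i (sourceVersion ω t) ω : ℝ≥0∞) ∂(noiseLaw n lamE lam) := by
  have hcast : Measurable fun m : ℕ => (m : ℝ≥0∞) := measurable_of_countable _
  have key : ∀ f : ℕ → Noise n → ℝ≥0∞, (∀ k, Measurable (f k)) →
      ∫⁻ ω, f (sourceVersion ω t) ω ∂(noiseLaw n lamE lam) =
        ∑' k, ∫⁻ ω, (epochEvent n t k).indicator (f k) ω ∂(noiseLaw n lamE lam) := by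
    intro f hf
    rw [← lintegral_tsum fun k => ((hf k).indicator (measurableSet_epochEvent t k)).aemeasurable]
    refine lintegral_congr_ae ?_
    filter_upwards [ae_noise_forall (ae_clock_pos .source), ae_updateEpoch_unbounded] with ω h1 h2
    rw [tsum_eq_single (sourceVersion ω t), Set.indicator_of_mem
      (mem_epochEvent_sourceVersion h1 h2 ht)]
    exact fun k hk => Set.indicator_of_notMem
      (fun h => hk (eq_sourceVersion_of_mem_epochEvent h1 h).symm) _
  rw [key (fun k ω => (backwardAge B C i k ω : ℝ≥0∞))
    (fun k => hcast.comp (measurable_backwardAge i k))]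
  simp_rw [← lintegral_epochEvent_age]
  exact key (fun k ω => (agesWithin B C (agesAtEpoch B C ω k) (ω k) (t - updateEpoch ω k) i : ℝ≥0∞))
    (fun k => hcast.comp (measurable_agesWithin_epoch k i
      (measurable_const.sub (measurable_updateEpoch k))))

lemma measurableSet_allUpdated : MeasurableSet (allUpdated n) := by
  simp only [allUpdated, Set.ofPred_forall]
  exact MeasurableSet.iInter fun i => measurableSet_le (by fun_prop) (by fun_prop)

lemma clockLaw_compl_allUpdated_lt_one : clockLaw n lamE lam (allUpdated n)ᶜ < 1 := by
  classical
  rw [prob_compl_eq_one_sub measurableSet_allUpdated]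
  refine ENNReal.sub_lt_self ENNReal.one_ne_top one_ne_zero ?_
  -- the source clock exceeds `1`, all the others do not
  let A : Clock n → Set ℝ := fun c => if c = .source then Set.Ioi 1 else Set.Iic 1
  let S : Finset (Clock n) := insert .source (Finset.univ.image fun i : Fin n => .update i 0)
  have hAm : ∀ c, MeasurableSet (A c) := fun c => by
    dsimp only [A]; split_ifs <;> measurability
  have hsub : Set.pi S A ⊆ allUpdated n := by
    intro ξ hξ i
    have h1 := hξ .source (by simp [S])
    have h2 := hξ (.update i 0) (by simp [S])
    simp only [A, if_true, reduceCtorEq, if_false, Set.mem_Ioi, Set.mem_Iic] at h1 h2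
    linarith
  refine fun h0 => absurd (measure_mono_null hsub h0) ?_
  rw [clockLaw, Measure.infinitePi_pi _ fun c _ => hAm c, ← ne_eq, Finset.prod_ne_zero_iff]
  intro c _
  have hIoi := expMeasure_Ioi (Clock.rate_pos (lamE := lamE) (lam := lam) c) 1
  by_cases hc : c = .source
  · simp only [A, if_pos hc, hIoi]
    exact (ENNReal.ofReal_pos.2 (Real.exp_pos _)).ne'
  · simp only [A, if_neg hc]
    intro h
    rw [← prob_compl_eq_one_iff measurableSet_Iic, Set.compl_Iic, hIoi, ENNReal.ofReal_eq_one,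
      Real.exp_eq_one_iff] at h
    have := Clock.rate_pos (lamE := lamE) (lam := lam) c
    norm_num at h
    linarith

/-- The number of `r` such that all nodes are updated in none of the intervals `0, …, r - 1`. It is a
geometric variable that bounds all backward ages. -/
noncomputable def waitingTime (ω : Noise n) : ℝ≥0∞ :=
  ∑' r : ℕ, (Set.pi (Finset.range r) fun _ => (allUpdated n)ᶜ).indicator 1 ω

lemma lintegral_waitingTime_ne_top :
    ∫⁻ ω, waitingTime ω ∂(noiseLaw n lamE lam) ≠ ∞ := by
  have hms : ∀ r : ℕ, MeasurableSet
      (Set.pi (Finset.range r) fun _ => (allUpdated n)ᶜ : Set (Noise n)) := fun r =>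
    .pi (Finset.countable_toSet _) fun _ _ => measurableSet_allUpdated.compl
  unfold waitingTime
  rw [lintegral_tsum fun r => (measurable_one.indicator (hms r)).aemeasurable]
  simp_rw [lintegral_indicator_one (hms _), noiseLaw_eq]
  simp_rw [Measure.infinitePi_pi (fun _ : ℕ => clockLaw n lamE lam)
    (fun _ _ => measurableSet_allUpdated.compl), Finset.prod_const, Finset.card_range]
  rw [ENNReal.tsum_geometric]
  exact ENNReal.inv_ne_top.2 (tsub_pos_of_lt clockLaw_compl_allUpdated_lt_one).ne'

/-- The backward ages converge almost surely, and are dominated by an integrable variable. -/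
lemma exists_limit_backwardAge (hn : 2 ≤ n) (hB : 0 < B) (hC : 0 ≤ C) (i : Fin n) :
    ∃ L : Noise n → ℝ≥0∞, ∀ᵐ ω ∂(noiseLaw n lamE lam),
      (∀ k, (backwardAge B C i k ω : ℝ≥0∞) ≤ waitingTime ω) ∧
      ∀ᶠ k in atTop, (backwardAge B C i k ω : ℝ≥0∞) = L ω := by
  classical
  have hex : ∀ᵐ ω ∂(noiseLaw n lamE lam), ∃ j, ω j ∈ allUpdated n := by
    filter_upwards [ae_frequently_notMem_infinitePi (fun _ : ℕ => clockLaw n lamE lam)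
      Function.injective_id (fun _ => measurableSet_allUpdated.compl)
      clockLaw_compl_allUpdated_lt_one (fun _ => le_rfl)] with ω h
    obtain ⟨q, -, hq⟩ := h 0
    exact ⟨q, by simpa using hq⟩
  refine ⟨fun ω => if h : ∃ j, ω j ∈ allUpdated n then backwardAge B C i (Nat.find h) ω else 0, ?_⟩
  filter_upwards [hex, ae_noise_forall ae_isRegular] with ω h hreg
  have hconst : ∀ k, Nat.find h ≤ k → backwardAge B C i k ω = backwardAge B C i (Nat.find h) ω :=
    fun k hk => backwardAge_eq_of_allUpdated hn hB hC i (hreg _) (Nat.find_spec h) hk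
  refine ⟨fun k => ?_, ?_⟩
  · have hle : ∀ m ≤ Nat.find h, (m : ℝ≥0∞) ≤ waitingTime ω := by
      intro m hm
      refine le_trans ?_ (ENNReal.sum_le_tsum (Finset.range m))
      have : ∀ r ∈ Finset.range m, (Set.pi (Finset.range r) fun _ =>
          (allUpdated n)ᶜ).indicator (1 : Noise n → ℝ≥0∞) ω = 1 := by
        intro r hr
        have hr' := Finset.mem_range.1 hr
        refine Set.indicator_of_mem (fun j hj => ?_) _
        have hj' := Finset.mem_range.1 (Finset.mem_coe.1 hj)
        exact Nat.find_min h (by omega)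
      rw [Finset.sum_congr rfl this]
      simp
    rcases le_total k (Nat.find h) with hk | hk
    · exact le_trans (by exact_mod_cast backwardAge_le i k ω) (hle k hk)
    · rw [hconst k hk]
      exact le_trans (by exact_mod_cast backwardAge_le i _ ω) (hle _ le_rfl)
  · filter_upwards [eventually_ge_atTop (Nat.find h)] with k hk
    rw [dif_pos h, hconst k hk]

/-- The steady-state mean age exists. As Poisson arrivals see time averages, it is the limit of the
mean ages immediately before the self-updates of the source. -/
lemma exists_isSteadyStateMeanAge (hn : 2 ≤ n) (hB : 0 < B) (hC : 0 ≤ C) (i : Fin n) :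
    ∃ a, IsSteadyStateMeanAge lamE lam B C i a ∧
      Tendsto (fun k => ∫ ω, (agesAtEpoch B C ω (k + 1) i : ℝ) ∂(noiseLaw n lamE lam)) atTop
        (𝓝 (a + 1)) := by
  have hcast : Measurable fun m : ℕ => (m : ℝ≥0∞) := measurable_of_countable _
  obtain ⟨L, hL⟩ := exists_limit_backwardAge (lamE := lamE) (lam := lam) hn hB hC i
  have hWtop := lintegral_waitingTime_ne_top (n := n) (lamE := lamE) (lam := lam)
  have hLle : ∫⁻ ω, L ω ∂(noiseLaw n lamE lam) ≠ ∞ := by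
    refine ne_top_of_le_ne_top hWtop (lintegral_mono_ae ?_)
    filter_upwards [hL] with ω h
    obtain ⟨k, hk⟩ := h.2.exists
    exact hk ▸ h.1 k
  have hbw : ∀ s : Noise n → ℕ, ∫⁻ ω, (backwardAge B C i (s ω) ω : ℝ≥0∞) ∂(noiseLaw n lamE lam) ≠ ∞ :=
    fun s => ne_top_of_le_ne_top hWtop (lintegral_mono_ae (hL.mono fun ω h => h.1 _))
  have hreal : ∀ (f : Noise n → ℕ), Measurable f → ∫ ω, (f ω : ℝ) ∂(noiseLaw n lamE lam) =
      (∫⁻ ω, (f ω : ℝ≥0∞) ∂(noiseLaw n lamE lam)).toReal := by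
    intro f hf
    rw [integral_eq_lintegral_of_nonneg_ae (Eventually.of_forall fun _ => Nat.cast_nonneg _)
      ((measurable_of_countable fun m : ℕ => (m : ℝ)).comp hf).aestronglyMeasurable]
    simp
  refine ⟨(∫⁻ ω, L ω ∂(noiseLaw n lamE lam)).toReal, ⟨fun t ht => ?_, ?_⟩, ?_⟩
  · refine ⟨((measurable_of_countable fun m : ℕ => (m : ℝ)).comp
      (measurable_versionAge t i)).aestronglyMeasurable, ?_⟩
    rw [hasFiniteIntegral_iff_ofReal (Eventually.of_forall fun _ => Nat.cast_nonneg _)]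
    simp only [ENNReal.ofReal_natCast]
    rw [lintegral_versionAge i ht]
    exact (hbw _).lt_top
  · have hN : ∀ t, Measurable fun ω : Noise n => sourceVersion ω t := fun t =>
      measurable_sSup_nat fun k => measurableSet_le (measurable_updateEpoch k) measurable_const
    have hmeas : ∀ t, Measurable fun ω : Noise n =>
        (backwardAge B C i (sourceVersion ω t) ω : ℝ≥0∞) := fun t =>
      hcast.comp ((measurable_from_prod_countable_right (f := fun p : ℕ × Noise n =>
        backwardAge B C i p.1 p.2) fun k => measurable_backwardAge i k).comp
          ((hN t).prodMk measurable_id))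
    have hlim := tendsto_lintegral_filter_of_dominated_convergence (l := atTop)
      (F := fun t ω => (backwardAge B C i (sourceVersion ω t) ω : ℝ≥0∞)) (f := L)
      (μ := noiseLaw n lamE lam) waitingTime (Eventually.of_forall hmeas)
      (Eventually.of_forall fun t => hL.mono fun ω h => h.1 _) hWtop (by
        filter_upwards [hL, ae_noise_forall (ae_clock_pos .source), ae_updateEpoch_unbounded]
          with ω h h1 h2
        exact tendsto_const_nhds.congr'
          (((tendsto_sourceVersion h1 h2).eventually h.2).mono fun t h => h.symm))
    refine ((ENNReal.tendsto_toReal hLle).comp hlim).congr' ?_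
    filter_upwards [eventually_ge_atTop 0] with t ht
    rw [hreal _ (measurable_versionAge t i), lintegral_versionAge i ht]
    rfl
  · have hlim := tendsto_lintegral_filter_of_dominated_convergence (l := atTop)
      (F := fun k ω => (backwardAge B C i k ω : ℝ≥0∞)) (f := L)
      (μ := noiseLaw n lamE lam) waitingTime
      (Eventually.of_forall fun k => hcast.comp (measurable_backwardAge i k))
      (Eventually.of_forall fun t => hL.mono fun ω h => h.1 _) hWtop
      (hL.mono fun ω h => tendsto_const_nhds.congr' (h.2.mono fun k h => h.symm))
    refine (((ENNReal.tendsto_toReal hLle).comp hlim).add_const 1).congr fun k => ?_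
    have hm : Measurable fun ω : Noise n => agesAtEpoch B C ω (k + 1) i :=
      measurable_agesAtEpoch_apply _ i
    rw [hreal _ hm, ← (measurePreserving_reverse k).lintegral_comp
      (f := fun ω => (agesAtEpoch B C ω (k + 1) i : ℝ≥0∞)) (hcast.comp hm)]
    simp only [agesAtEpoch_reverse_succ, Function.comp_apply, Nat.cast_add, Nat.cast_one]
    rw [lintegral_add_right _ measurable_const, lintegral_const, measure_univ, mul_one,
      ENNReal.toReal_add (hbw fun _ => k) ENNReal.one_ne_top, ENNReal.toReal_one]

end Convergence

/-! ### The asymptotic bound -/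

/-- A steady-state mean age together with the limit of the mean ages at the self-updates. -/
def IsStationaryMean {n : ℕ} (lamE lam B C : ℝ) (i : Fin n) (a : ℝ) : Prop :=
  IsSteadyStateMeanAge lamE lam B C i a ∧
    Tendsto (fun k => ∫ ω, (agesAtEpoch B C ω (k + 1) i : ℝ) ∂(noiseLaw n lamE lam)) atTop
      (𝓝 (a + 1))

lemma IsStationaryMean.le {n : ℕ} {lamE lam C : ℝ} (hlamE : 0 < lamE) (hlam : 0 < lam)
    (hn : 2 ≤ n) (hC : 0 ≤ C) {i : Fin n} {a : ℝ}
    (ha : IsStationaryMean lamE lam (n * lam) C i a) {ε : ℝ} (hε : 0 ≤ ε)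
    (hCε : lam * C * crossMomentBound lamE lam ε ≤ lam / (lamE + lam) * ε) :
    a ≤ 2 * lamE / lam + 1 + ε := by
  have : Fact (0 < lamE) := ⟨hlamE⟩
  have : Fact (0 < lam) := ⟨hlam⟩
  have h := le_of_tendsto' ha.2 fun k => integral_agesAtEpoch_le hn hC hε hCε i (k + 1)
  have h2 : 2 * ((lamE + lam) / lam) = 2 * lamE / lam + 2 := by field_simp
  linarith

/-- The steady-state mean ages of all networks, for a sequence of back-off constants that tends
to zero. -/
lemma exists_steadyState_family {lamE lam : ℝ} (hlamE : 0 < lamE) (hlam : 0 < lam) {C : ℕ → ℝ}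
    (hC : ∀ n, 0 ≤ C n) (hClim : Tendsto C atTop (𝓝 0)) :
    ∃ a : (n : ℕ) → Fin n → ℝ,
      (∀ n, 2 ≤ n → ∀ i : Fin n, IsSteadyStateMeanAge lamE lam (n * lam) (C n) i (a n i)) ∧
      ∀ ε : ℝ, 0 < ε → ∀ᶠ n : ℕ in atTop, ∀ i : Fin n, a n i ≤ 2 * lamE / lam + 1 + ε := by
  have : Fact (0 < lamE) := ⟨hlamE⟩
  have : Fact (0 < lam) := ⟨hlam⟩
  have hex : ∀ n (i : Fin n), ∃ a, 2 ≤ n → IsStationaryMean lamE lam (n * lam) (C n) i a := by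
    intro n i
    by_cases hn : 2 ≤ n
    · obtain ⟨a, ha⟩ := exists_isSteadyStateMeanAge (lamE := lamE) (lam := lam) (B := n * lam) hn
        (by positivity) (hC n) i
      exact ⟨a, fun _ => ha⟩
    · exact ⟨0, fun h => absurd h hn⟩
  choose a ha using hex
  refine ⟨a, fun n hn i => (ha n i hn).1, fun ε hε => ?_⟩
  have hlim : Tendsto (fun n => lam * C n * crossMomentBound lamE lam ε) atTop (𝓝 0) := by
    simpa using (hClim.const_mul lam).mul_const (crossMomentBound lamE lam ε)
  filter_upwards [hlim.eventually (gt_mem_nhds (show 0 < lam / (lamE + lam) * ε by positivity)),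
    eventually_ge_atTop 2] with n h hn i
  exact (ha n i hn).le hlamE hlam hn (hC n) hε.le h.le

/-- An eventual uniform bound holds for all sizes after enlarging it by the finitely many exceptional
values. -/
lemma exists_forall_le_of_eventually {a : (n : ℕ) → Fin n → ℝ} {b : ℝ}
    (h : ∀ᶠ n in atTop, ∀ i, a n i ≤ b) : ∃ K, ∀ n i, a n i ≤ K := by
  obtain ⟨N, hN⟩ := eventually_atTop.1 h
  have hs : ∀ n, 0 ≤ ∑ i, |a n i| := fun n => Finset.sum_nonneg fun _ _ => abs_nonneg _
  have hS : 0 ≤ ∑ n ∈ Finset.range N, ∑ i, |a n i| := Finset.sum_nonneg fun n _ => hs n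
  refine ⟨|b| + ∑ n ∈ Finset.range N, ∑ i, |a n i|, fun n i => ?_⟩
  rcases le_or_gt N n with hn | hn
  · linarith [hN n hn i, le_abs_self b]
  · have h1 := Finset.single_le_sum (fun n _ => hs n) (Finset.mem_range.2 hn)
    have h2 := Finset.single_le_sum (f := fun i => |a n i|) (fun _ _ => abs_nonneg _)
      (Finset.mem_univ i)
    linarith [le_abs_self (a n i), abs_nonneg b]

end Asuman

theorem theorem1 (lamE lam : ℝ) (hlamE : 0 < lamE) (hlam : 0 < lam)
    (C : ℕ → ℝ) (hCpos : ∀ n, 0 < C n) (hCbdd : BddAbove (Set.range C))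
    (hClim : Tendsto C atTop (𝓝 0)) :
    ∃ a a₀ : (n : ℕ) → Fin n → ℝ,
      -- steady-state mean ages with back-off constant `C n`, and with back-off constant `0`
      (∀ n, 2 ≤ n → ∀ i : Fin n,
        Asuman.IsSteadyStateMeanAge lamE lam (n * lam) (C n) i (a n i)) ∧
      (∀ n, 2 ≤ n → ∀ i : Fin n,
        Asuman.IsSteadyStateMeanAge lamE lam (n * lam) 0 i (a₀ n i)) ∧
      -- the mean age is `O(1)`
      (∃ K : ℝ, ∀ n, 2 ≤ n → ∀ i : Fin n, a n i ≤ K) ∧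
      -- asymptotic upper bound, the same as for back-off constant `0`
      (∀ ε : ℝ, 0 < ε → ∀ᶠ n : ℕ in atTop, ∀ i : Fin n, a n i ≤ 2 * lamE / lam + 1 + ε) ∧
      (∀ ε : ℝ, 0 < ε → ∀ᶠ n : ℕ in atTop, ∀ i : Fin n, a₀ n i ≤ 2 * lamE / lam + 1 + ε) := by
  obtain ⟨a, ha, ha'⟩ := Asuman.exists_steadyState_family hlamE hlam (fun n => (hCpos n).le) hClim
  obtain ⟨a₀, ha₀, ha₀'⟩ := Asuman.exists_steadyState_family hlamE hlam (C := fun _ => 0)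
    (fun _ => le_rfl) tendsto_const_nhds
  obtain ⟨K, hK⟩ := Asuman.exists_forall_le_of_eventually (ha' 1 one_pos)
  exact ⟨a, a₀, ha, ha₀, ⟨K, fun n _ i => hK n i⟩, ha', ha₀'⟩
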